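/- **Setting.** Let $Y$ be a Noetherian separated scheme and let $\mathcal{A}=\bigoplus_{i\in\mathbb{Z}}\mathcal{A}_i$ be a quasi-coherent sheaf of commutative $\mathbb{Z}$-graded $\mathcal{O}_Y$-algebras such that $\mathcal{A}(U)$ is a Noetherian ring for every affine open $U\subset Y$ and $\mathcal{A}_0$ is coherent over $\mathcal{O}_Y$. Let $\mathrm{Gr}(\mathcal{A})$ be the category of quasi-coherent graded $\mathcal{A}$-modules (with degree $0$ morphisms) and $\mathcal{D}(\mathrm{Gr}(\mathcal{A}))$ its derived category. For $\mathcal{M}\in\mathcal{D}(\mathrm{Gr}(\mathcal{A}))$ write $\mathcal{M}_i\in\mathcal{D}(\mathrm{QCoh}(Y))$ for the weight $i$ component, and let $\mathcal{M}(a)$ be the twist $\mathcal{M}(a)_i=\mathcal{M}_{i+a}$. A map in $\mathcal{D}(\mathrm{Gr}(\mathcal{A}))$ is a quasi-isomorphism in weight $i$ if it induces isomorphisms on the weight $i$ components of all cohomology sheaves. Let $I^+=\mathcal{A}_{>0}\cdot\mathcal{A}$ and $I^-=\mathcal{A}_{<0}\cdot\mathcal{A}$. For $I=I^{\pm}$ let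 ${\bm R}\Gamma_I$ be the right derived functor of the functor sending a graded module to its submodule of sections locally killed by a power of $I$, and let $\check{\mathcal{C}}_I(\mathcal{A})$ be the Čech complex, that is, the third vertex of the local cohomology triangle $${\bm R}\Gamma_I(\mathcal{A})\to\mathcal{A}\xrightarrow{\ \eta\ }\check{\mathcal{C}}_I(\mathcal{A})\to{\bm R}\Gamma_I(\mathcal{A})[1];$$ write $\eta^{\pm}$ for $\eta$ when $I=I^{\pm}$. Let $\omega$ be a dualizing complex in $\mathcal{D}^b_{\mathrm{coh}}(\mathrm{QCoh}(Y))$. Let $\mathbb{D}_Y={\bm R}\underline{\mathcal{H}om}_{\mathcal{O}_Y}(-,\omega):\mathcal{D}(\mathrm{Gr}(\mathcal{A}))^{\mathrm{op}}\to\mathcal{D}(\mathrm{Gr}(\mathcal{A}))$ be the associated duality functor, with weight components $\mathbb{D}_Y(\mathcal{M})_i={\bm R}\mathcal{H}om_{\mathcal{O}_Y}(\mathcal{M}_{-i},\omega)$; here the internal Hom is taken in quasi-coherent sheaves, i.e. it is the coherator of the sheaf Hom. A *homological flip* (resp. *homological flop*) is a sextuple $(Y,\omega,\mathcal{A},a,\Phi^-,\Phi^+)$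 with $Y,\omega,\mathcal{A}$ as above, $a\in\mathbb{Z}$ with $a>0$ (resp. $a=0$), and maps $$\Phi^{\pm}:\check{\mathcal{C}}_{I^{\pm}}(\mathcal{A})(a)\to\mathbb{D}_Y(\check{\mathcal{C}}_{I^{\pm}}(\mathcal{A}))$$ in $\mathcal{D}(\mathrm{Gr}(\mathcal{A}))$ that are quasi-isomorphisms in all weights and are compatible in the sense that $$\mathbb{D}_Y(\eta^+)\circ\Phi^+\circ\eta^+(a)=\mathbb{D}_Y(\eta^-)\circ\Phi^-\circ\eta^-(a):\ \mathcal{A}(a)\to\mathbb{D}_Y(\mathcal{A}).$$ **Theorem.** Let $(Y,\omega,\mathcal{A},a,\Phi^-,\Phi^+)$ be a homological flip or a homological flop. Then there is a map $$\Psi:{\bm R}\Gamma_{I^+}(\mathcal{A})(a)[1]\to\mathbb{D}_Y({\bm R}\Gamma_{I^-}(\mathcal{A}))\quad\text{in }\mathcal{D}(\mathrm{Gr}(\mathcal{A}))$$ with the following property: whenever $c^+,c^-\in\mathbb{Z}$ are integers such that ${\bm R}\Gamma_{I^+}(\mathcal{A})_i\simeq 0$ for all $i\ge c^+$ and ${\bm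 R}\Gamma_{I^-}(\mathcal{A})_i\simeq 0$ for all $i\le c^-$, the map $\Psi$ is a quasi-isomorphism in every weight $i$ such that $$i\ge\max\{-c^-,\,c^+-a\}\qquad\text{or}\qquad i\le\min\{-c^+,\,c^--a\}.$$ -/

import Mathlib

open CategoryTheory CategoryTheory.Limits AlgebraicGeometry Opposite

universe u

namespace HFF

/-- A quasi-coherent sheaf of commutative `Λ`-graded algebras on the scheme `Y`, described by its
sections on the affine open sets: a graded ring `obj U` with a structure map from `Γ(Y, U)` to the
part of degree zero for each affine open `U`, compatible restriction maps, and the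
quasi-coherence condition that for `f : Γ(Y, U)` the sections on the basic open set `D(f)` are the
localization at `f` of the sections on `U` (surjectivity: `qc_surj`, injectivity: `qc_inj`). -/
structure GradedAlgebra (Y : Scheme.{u}) (Λ : Type) [AddCommGroup Λ] [DecidableEq Λ] where
  obj : Y.affineOpens → Type u
  [commRing : ∀ U, CommRing (obj U)]
  res : ∀ {U V : Y.affineOpens}, V ≤ U → obj U →+* obj V
  res_self : ∀ {U : Y.affineOpens} (h : U ≤ U) (a : obj U), res h a = a
  res_res : ∀ {U V W : Y.affineOpens} (h : V ≤ U) (h' : W ≤ V) (a : obj U),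
    res h' (res h a) = res (h'.trans h) a
  deg : ∀ U : Y.affineOpens, Λ → AddSubgroup (obj U)
  one_mem : ∀ U, (1 : obj U) ∈ deg U 0
  mul_mem : ∀ {U i j} {a b : obj U}, a ∈ deg U i → b ∈ deg U j → a * b ∈ deg U (i + j)
  isInternal : ∀ U, DirectSum.IsInternal (deg U)
  res_mem : ∀ {U V : Y.affineOpens} (h : V ≤ U) {i : Λ} {a : obj U},
    a ∈ deg U i → res h a ∈ deg V i
  str : ∀ U : Y.affineOpens, Γ(Y, U.1) →+* obj U
  str_mem : ∀ (U : Y.affineOpens) (r : Γ(Y, U.1)), str U r ∈ deg U 0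
  res_str : ∀ {U V : Y.affineOpens} (h : V ≤ U) (r : Γ(Y, U.1)),
    res h (str U r) = str V (Y.presheaf.map (homOfLE (show V.1 ≤ U.1 from h)).op r)
  qc_surj : ∀ (U : Y.affineOpens) (f : Γ(Y, U.1)) (y : obj (Y.affineBasicOpen f)),
    ∃ (n : ℕ) (x : obj U), res (Y.affineBasicOpen_le f) x =
      res (Y.affineBasicOpen_le f) (str U f) ^ n * y
  qc_inj : ∀ (U : Y.affineOpens) (f : Γ(Y, U.1)) (x : obj U),
    res (Y.affineBasicOpen_le f) x = 0 → ∃ n : ℕ, str U f ^ n * x = 0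

attribute [instance] GradedAlgebra.commRing

variable {Y : Scheme.{u}} {Λ : Type} [AddCommGroup Λ] [DecidableEq Λ]

/-- The pairs of an affine open set and a degree. They are the objects of a category in which a
morphism `(U, i) ⟶ (V, j)` exists only if `V ⊆ U` and is then a homogeneous section of `A` over `V`
of degree `j - i`. An additive functor from this category to abelian groups is the same thing as a
presheaf, on the affine open sets, of graded `A`-modules. -/
structure Cell (A : GradedAlgebra Y Λ) : Type u where
  U : Y.affineOpens
  i : Λ

namespace Cell
variable {A : GradedAlgebra Y Λ}

/-- The morphisms of cells: restrict to a smaller affine open set, and multiply by a homogeneous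
section. -/
@[ext]
structure Hom (X Z : Cell A) : Type u where
  val : A.obj Z.U
  hle : Z.U ≤ X.U
  mem : val ∈ A.deg Z.U (Z.i - X.i)

instance : SmallCategory (Cell A) where
  Hom X Z := Hom X Z
  id X := ⟨1, le_rfl, by simpa using A.one_mem X.U⟩
  comp f g := ⟨g.val * A.res g.hle f.val, g.hle.trans f.hle, by
    have := A.mul_mem g.mem (A.res_mem g.hle f.mem)
    simpa using this⟩
  id_comp f := by
    apply Hom.ext; simp
  comp_id f := by
    apply Hom.ext; simp [A.res_self]
  assoc f g h := by
    apply Hom.ext; simp [A.res_res, mul_assoc]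

end Cell

namespace Cell
variable {A : GradedAlgebra Y Λ}

@[simp] lemma id_val (X : Cell A) : Hom.val (𝟙 X) = 1 := rfl

@[simp] lemma comp_val {X Z W : Cell A} (f : X ⟶ Z) (g : Z ⟶ W) :
    Hom.val (f ≫ g) = g.val * A.res g.hle f.val := rfl

@[ext] lemma hom_ext {X Z : Cell A} {f g : X ⟶ Z} (h : Hom.val f = Hom.val g) : f = g :=
  Hom.ext h

/-- The restriction from `U` to `V` followed by the multiplication by a function on `V`. -/
def scal {U V : Y.affineOpens} (h : V ≤ U) (r : Γ(Y, V.1)) (i : Λ) :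
    (⟨U, i⟩ : Cell A) ⟶ ⟨V, i⟩ :=
  Hom.mk (A.str V r) h (by simpa using A.str_mem V r)

@[simp] lemma scal_val {U V : Y.affineOpens} (h : V ≤ U) (r : Γ(Y, V.1)) (i : Λ) :
    Hom.val (scal (A := A) h r i) = A.str V r := rfl

end Cell

variable {A : GradedAlgebra Y Λ}

/-- The restriction of functions. -/
abbrev rs {U V : Y.affineOpens} (h : V ≤ U) : Γ(Y, U.1) →+* Γ(Y, V.1) :=
  (Y.presheaf.map (homOfLE (show V.1 ≤ U.1 from h)).op).hom

/-- A presheaf of graded `A`-modules on the affine open sets is (the restriction of) a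
quasi-coherent sheaf of graded `A`-modules if each of its weight components satisfies the
localization condition for all basic open sets. -/
structure IsGrMod (M : Cell A ⥤ AddCommGrpCat.{u}) : Prop where
  map_add : ∀ {X Z : Cell A} (a b c : X ⟶ Z), c.val = a.val + b.val →
    M.map c = M.map a + M.map b
  qc_surj : ∀ (U : Y.affineOpens) (f : Γ(Y, U.1)) (i : Λ)
    (y : M.obj ⟨Y.affineBasicOpen f, i⟩), ∃ (n : ℕ) (x : M.obj ⟨U, i⟩),
      M.map (Cell.scal (Y.affineBasicOpen_le f) 1 i) x =
        M.map (Cell.scal le_rfl (rs (Y.affineBasicOpen_le f) f ^ n) i) y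
  qc_inj : ∀ (U : Y.affineOpens) (f : Γ(Y, U.1)) (i : Λ) (x : M.obj ⟨U, i⟩),
    M.map (Cell.scal (Y.affineBasicOpen_le f) 1 i) x = 0 →
      ∃ n : ℕ, M.map (Cell.scal le_rfl (f ^ n) i) x = 0

variable (A) in
def isGrMod : ObjectProperty (Cell A ⥤ AddCommGrpCat.{u}) := fun M => IsGrMod M


section closure

section general
variable {C : Type*} [Category* C] {D : Type*} [Category* D]

lemma isIso_app_of_isColimit {F G : C ⥤ D} (α : F ⟶ G) {J : Type*} [Category* J]
    [PreservesColimitsOfShape J F] [PreservesColimitsOfShape J G]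
    {K : J ⥤ C} {c : Cocone K} (hc : IsColimit c) (h : ∀ j, IsIso (α.app (K.obj j))) :
    IsIso (α.app c.pt) := by
  have : ∀ j, IsIso ((Functor.whiskerLeft K α).app j) := h
  have : IsIso (Functor.whiskerLeft K α) := NatIso.isIso_of_isIso_app _
  have h1 := isColimitOfPreserves F hc
  have h2 := isColimitOfPreserves G hc
  have : α.app c.pt =
      (h1.coconePointsIsoOfNatIso h2 (asIso (Functor.whiskerLeft K α))).hom := by
    refine h1.hom_ext fun j => ?_
    rw [IsColimit.comp_coconePointsIsoOfNatIso_hom]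
    simp
  rw [this]
  infer_instance

lemma isIso_app_of_isLimit {F G : C ⥤ D} (α : F ⟶ G) {J : Type*} [Category* J]
    [PreservesLimitsOfShape J F] [PreservesLimitsOfShape J G]
    {K : J ⥤ C} {c : Cone K} (hc : IsLimit c) (h : ∀ j, IsIso (α.app (K.obj j))) :
    IsIso (α.app c.pt) := by
  have : ∀ j, IsIso ((Functor.whiskerLeft K α).app j) := h
  have : IsIso (Functor.whiskerLeft K α) := NatIso.isIso_of_isIso_app _
  have h1 := isLimitOfPreserves F hc
  have h2 := isLimitOfPreserves G hc
  have : α.app c.pt =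
      (h1.conePointsIsoOfNatIso h2 (asIso (Functor.whiskerLeft K α))).hom := by
    refine h2.hom_ext fun j => ?_
    rw [IsLimit.conePointsIsoOfNatIso_hom_comp]
    simp
  rw [this]
  infer_instance

end general

variable (A) in
def isAdd : ObjectProperty (Cell A ⥤ AddCommGrpCat.{u}) := fun M =>
  ∀ {X Z : Cell A} (a b c : X ⟶ Z), c.val = a.val + b.val → M.map c = M.map a + M.map b

section
variable (U : Y.affineOpens) (f : Γ(Y, U.1)) (i : Λ)

lemma isUnit_rs : IsUnit (rs (Y.affineBasicOpen_le f) f) :=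
  RingedSpace.isUnit_res_basicOpen _ f

/-- The inverse of `f` on the basic open set of `f`. -/
noncomputable def finv : Γ(Y, (Y.affineBasicOpen f).1) := ((isUnit_rs U f).unit⁻¹ : _ˣ)

lemma finv_mul : finv U f * rs (Y.affineBasicOpen_le f) f = 1 := (isUnit_rs U f).val_inv_mul

variable (A) in
/-- The diagram of the successive multiplications by `f`. -/
def sq : ℕ ⥤ Cell A where
  obj _ := ⟨U, i⟩
  map {m n} _ := Cell.scal le_rfl (f ^ (n - m)) i
  map_id m := by ext; simp
  map_comp {k m n} p q := by
    ext
    have h : n - k = (n - m) + (m - k) := by have := leOfHom p; have := leOfHom q; omega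
    simp [h, pow_add, A.res_self]

variable (A) in
/-- The cocone of the maps `x ↦ f ^ (- n) x` to the sections on the basic open set. -/
noncomputable def kap : Cocone (sq A U f i) where
  pt := ⟨Y.affineBasicOpen f, i⟩
  ι :=
    { app := fun n => Cell.scal (U := U) (Y.affineBasicOpen_le f) (finv U f ^ n) i
      naturality := by
        intro m n p
        have h : n = m + (n - m) := by have := leOfHom p; omega
        have e : finv U f ^ n * rs (Y.affineBasicOpen_le f) (f ^ (n - m)) = finv U f ^ m := by
          conv_lhs => rw [h, pow_add]
          rw [map_pow, mul_assoc, Nat.add_sub_cancel_left, ← mul_pow, finv_mul, one_pow, mul_one]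
        refine Eq.trans ?_ (Category.comp_id _).symm
        refine Cell.hom_ext ?_
        refine Eq.trans (b := A.str _ (finv U f ^ n * rs (Y.affineBasicOpen_le f) (f ^ (n - m)))) ?_
          (congrArg _ e)
        rw [map_mul, ← A.res_str]
        rfl }

variable (A) in
/-- The localization at `f` of the sections over `U`, as a functor. -/
noncomputable def locFunctor : (Cell A ⥤ AddCommGrpCat.{u}) ⥤ AddCommGrpCat.{u} :=
  (Functor.whiskeringLeft _ _ _).obj (sq A U f i) ⋙ colim

variable (A) in
noncomputable abbrev evFunctor (X : Cell A) : (Cell A ⥤ AddCommGrpCat.{u}) ⥤ AddCommGrpCat.{u} :=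
  (evaluation _ _).obj X

variable (A) in
/-- The comparison from the localization to the sections on the basic open set. -/
noncomputable def locMap : locFunctor A U f i ⟶ evFunctor A ⟨Y.affineBasicOpen f, i⟩ where
  app M := colimit.desc (sq A U f i ⋙ M) (M.mapCocone (kap A U f i))
  naturality M N φ := by
    apply colimit.hom_ext
    intro j
    dsimp [locFunctor, evFunctor]
    erw [ι_colimMap_assoc, colimit.ι_desc, colimit.ι_desc_assoc]
    exact (φ.naturality _).symm

instance {J : Type*} [Category* J] [HasColimitsOfShape J AddCommGrpCat.{u}] :
    PreservesColimitsOfShape J (locFunctor A U f i) := by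
  unfold locFunctor; infer_instance
instance : HasExactColimitsOfShape ℕ AddCommGrpCat.{u} := by
  have := hasFilteredColimitsOfSize_of_univLE.{0, u, 0, u} (C := AddCommGrpCat.{u})
  have : AB5OfSize.{0, 0} AddCommGrpCat.{u} := AB5OfSize_of_univLE.{0, 0, u, u} _
  infer_instance

instance : PreservesFiniteLimits (locFunctor A U f i) := by
  unfold locFunctor; infer_instance
instance : PreservesColimitsOfShape ℕ (forget AddCommGrpCat.{u}) := by
  have := preservesSmallestFilteredColimits_of_preservesFilteredColimits.{u, u}
    (forget AddCommGrpCat.{u})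
  infer_instance


lemma Cell.scal_comp {U V W : Y.affineOpens} (h : V ≤ U) (h' : W ≤ V) (r : Γ(Y, V.1))
    (s : Γ(Y, W.1)) (i : Λ) :
    Cell.scal (A := A) h r i ≫ Cell.scal h' s i = Cell.scal (h'.trans h) (s * rs h' r) i := by
  ext
  simp [A.res_str]

lemma map_scal_scal (M : Cell A ⥤ AddCommGrpCat.{u}) {U V W : Y.affineOpens} (h : V ≤ U)
    (h' : W ≤ V) (r : Γ(Y, V.1)) (s : Γ(Y, W.1)) (i : Λ) (x : M.obj ⟨U, i⟩) :
    M.map (Cell.scal h' s i) (M.map (Cell.scal h r i) x) =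
      M.map (Cell.scal (h'.trans h) (s * rs h' r) i) x := by
  rw [← Cell.scal_comp, M.map_comp]
  rfl

lemma rs_self {Y : Scheme.{u}} {V : Y.affineOpens} (h : V ≤ V) (r : Γ(Y, V.1)) : rs h r = r := by
  change Y.presheaf.map (𝟙 _) r = r
  simp

lemma map_scal_one (M : Cell A ⥤ AddCommGrpCat.{u}) (x : M.obj ⟨U, i⟩) :
    M.map (Cell.scal le_rfl 1 i) x = x := by
  have : Cell.scal (A := A) (U := U) le_rfl 1 i = 𝟙 _ := by ext; simp
  rw [this, M.map_id]
  rfl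

lemma isIso_locMap_iff (M : Cell A ⥤ AddCommGrpCat.{u}) :
    IsIso ((locMap A U f i).app M) ↔
      (∀ y : M.obj ⟨Y.affineBasicOpen f, i⟩, ∃ (n : ℕ) (x : M.obj ⟨U, i⟩),
        M.map (Cell.scal (Y.affineBasicOpen_le f) 1 i) x =
          M.map (Cell.scal le_rfl (rs (Y.affineBasicOpen_le f) f ^ n) i) y) ∧
      (∀ x : M.obj ⟨U, i⟩,
        M.map (Cell.scal (Y.affineBasicOpen_le f) 1 i) x = 0 →
          ∃ n : ℕ, M.map (Cell.scal le_rfl (f ^ n) i) x = 0) := by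
  have key : ∀ (n : ℕ) (x : M.obj ⟨U, i⟩), (locMap A U f i).app M
      (colimit.ι (sq A U f i ⋙ M) n x) =
      M.map (Cell.scal (Y.affineBasicOpen_le f) (finv U f ^ n) i) x := by
    intro n x
    exact ConcreteCategory.congr_hom (colimit.ι_desc (M.mapCocone (kap A U f i)) n) x
  have k1 : ∀ (n : ℕ) (x : M.obj ⟨U, i⟩), M.map (Cell.scal le_rfl (rs (Y.affineBasicOpen_le f) f ^ n) i)
      (M.map (Cell.scal (Y.affineBasicOpen_le f) (finv U f ^ n) i) x) =
      M.map (Cell.scal (Y.affineBasicOpen_le f) 1 i) x := by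
    intro n x
    rw [map_scal_scal]
    have : rs (Y.affineBasicOpen_le f) f ^ n * rs le_rfl (finv U f ^ n) = 1 := by
      rw [rs_self, ← mul_pow, mul_comm, finv_mul, one_pow]
    rw [this]
  have k2 : ∀ (n : ℕ) (y : M.obj ⟨Y.affineBasicOpen f, i⟩),
      M.map (Cell.scal (A := A) (U := Y.affineBasicOpen f) le_rfl (finv U f ^ n) i)
        (M.map (Cell.scal le_rfl (rs (Y.affineBasicOpen_le f) f ^ n) i) y) = y := by
    intro n y
    rw [map_scal_scal, rs_self, ← mul_pow, finv_mul, one_pow, map_scal_one]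
  have k3 : ∀ (n : ℕ) (x : M.obj ⟨U, i⟩),
      M.map (Cell.scal (A := A) (U := Y.affineBasicOpen f) le_rfl (finv U f ^ n) i)
        (M.map (Cell.scal (Y.affineBasicOpen_le f) 1 i) x) =
      M.map (Cell.scal (Y.affineBasicOpen_le f) (finv U f ^ n) i) x := by
    intro n x
    rw [map_scal_scal, map_one, mul_one]
  have k4 : ∀ (m n : ℕ) (h : m ⟶ n) (x : M.obj ⟨U, i⟩), (sq A U f i ⋙ M).map h x =
      M.map (Cell.scal le_rfl (f ^ (n - m)) i) x := fun m n h x => rfl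
  rw [ConcreteCategory.isIso_iff_bijective]
  constructor
  · rintro ⟨h1, h2⟩
    constructor
    · intro y
      obtain ⟨z, hz⟩ := h2 y
      obtain ⟨n, x, rfl⟩ := Concrete.colimit_exists_rep (sq A U f i ⋙ M) z
      refine ⟨n, x, ?_⟩
      exact (k1 n x).symm.trans (congrArg _ ((key n x).symm.trans hz))
    · intro x hx
      have h3 : colimit.ι (sq A U f i ⋙ M) 0 x = 0 := by
        apply h1
        refine (key 0 x).trans ?_
        rw [← k3, hx, map_zero]
        exact (map_zero ((locMap A U f i).app M).hom).symm
      have h4 : colimit.ι (sq A U f i ⋙ M) 0 x = colimit.ι (sq A U f i ⋙ M) 0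
          (0 : M.obj ⟨U, i⟩) :=
        h3.trans (map_zero (colimit.ι (sq A U f i ⋙ M) 0).hom).symm
      obtain ⟨n, h, h', e⟩ := Concrete.colimit_exists_of_rep_eq (sq A U f i ⋙ M) _ _ h4
      refine ⟨n, (k4 _ _ h _).symm.trans (e.trans ?_)⟩
      exact map_zero ((sq A U f i ⋙ M).map h').hom
  · rintro ⟨h1, h2⟩
    constructor
    · refine (injective_iff_map_eq_zero ((locMap A U f i).app M).hom).2 ?_
      intro z hz
      obtain ⟨n, x, rfl⟩ := Concrete.colimit_exists_rep (sq A U f i ⋙ M) z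
      have hz' := (key n x).symm.trans hz
      have := k1 n x
      rw [hz', map_zero] at this
      obtain ⟨k, hk⟩ := h2 x this.symm
      have e : (sq A U f i ⋙ M).map (homOfLE (Nat.le_add_right n k)) x = 0 := by
        exact (k4 _ _ _ _).trans (by rw [Nat.add_sub_cancel_left]; exact hk)
      rw [← colimit.w (sq A U f i ⋙ M) (homOfLE (Nat.le_add_right n k))]
      refine (ConcreteCategory.comp_apply _ _ _).trans ?_
      rw [e, map_zero]
      rfl
    · intro y
      obtain ⟨n, x, hx⟩ := h1 y
      refine ⟨colimit.ι (sq A U f i ⋙ M) n x, (key n x).trans ?_⟩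
      exact ((k3 n x).symm.trans (congrArg _ hx)).trans (k2 n y)

end

lemma isGrMod_iff (M : Cell A ⥤ AddCommGrpCat.{u}) :
    isGrMod A M ↔ isAdd A M ∧ ∀ U f i, IsIso ((locMap A U f i).app M) := by
  simp only [isIso_locMap_iff]
  exact ⟨fun h => ⟨h.map_add, fun U f i => ⟨h.qc_surj U f i, h.qc_inj U f i⟩⟩,
    fun h => ⟨h.1, fun U f i => (h.2 U f i).1, fun U f i => (h.2 U f i).2⟩⟩

lemma isAdd_of_isLimit {J : Type*} [Category* J] [HasLimitsOfShape J AddCommGrpCat.{u}]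
    {K : J ⥤ Cell A ⥤ AddCommGrpCat.{u}} {c : Cone K} (hc : IsLimit c)
    (h : ∀ j, isAdd A (K.obj j)) : isAdd A c.pt := by
  intro X Z a b s hs
  have hZ := isLimitOfPreserves (evFunctor A Z) hc
  refine hZ.hom_ext fun j => ?_
  have e : ∀ t : X ⟶ Z, c.pt.map t ≫ ((evFunctor A Z).mapCone c).π.app j =
    (c.π.app j).app X ≫ (K.obj j).map t := fun t => (c.π.app j).naturality t
  refine (e s).trans ?_
  rw [h j a b s hs, Preadditive.comp_add, ← e, ← e]
  exact (Preadditive.add_comp _ _ _ _ _ _).symm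

lemma isAdd_of_isColimit {J : Type*} [Category* J] [HasColimitsOfShape J AddCommGrpCat.{u}]
    {K : J ⥤ Cell A ⥤ AddCommGrpCat.{u}} {c : Cocone K} (hc : IsColimit c)
    (h : ∀ j, isAdd A (K.obj j)) : isAdd A c.pt := by
  intro X Z a b s hs
  have hZ := isColimitOfPreserves (evFunctor A X) hc
  refine hZ.hom_ext fun j => ?_
  have e : ∀ t : X ⟶ Z, ((evFunctor A X).mapCocone c).ι.app j ≫ c.pt.map t =
    (K.obj j).map t ≫ (c.ι.app j).app Z := fun t => ((c.ι.app j).naturality t).symm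
  refine (e s).trans ?_
  rw [h j a b s hs, Preadditive.add_comp, ← e, ← e]
  exact (Preadditive.comp_add _ _ _ _ _ _).symm

lemma isGrMod_of_isColimit {J : Type*} [Category* J] [HasColimitsOfShape J AddCommGrpCat.{u}]
    {K : J ⥤ Cell A ⥤ AddCommGrpCat.{u}} {c : Cocone K} (hc : IsColimit c)
    (h : ∀ j, isGrMod A (K.obj j)) : isGrMod A c.pt := by
  simp only [isGrMod_iff] at h ⊢
  exact ⟨isAdd_of_isColimit hc fun j => (h j).1,
    fun U f i => isIso_app_of_isColimit _ hc fun j => (h j).2 U f i⟩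

lemma isGrMod_of_isLimit {J : Type} [SmallCategory J] [FinCategory J]
    {K : J ⥤ Cell A ⥤ AddCommGrpCat.{u}} {c : Cone K} (hc : IsLimit c)
    (h : ∀ j, isGrMod A (K.obj j)) : isGrMod A c.pt := by
  simp only [isGrMod_iff] at h ⊢
  exact ⟨isAdd_of_isLimit hc fun j => (h j).1,
    fun U f i => isIso_app_of_isLimit _ hc fun j => (h j).2 U f i⟩

instance {J : Type*} [Category* J] [HasColimitsOfShape J AddCommGrpCat.{u}] :
    (isGrMod A).IsClosedUnderColimitsOfShape J where
  colimitsOfShape_le := by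
    rintro M ⟨h⟩
    exact isGrMod_of_isColimit h.isColimit h.prop_diag_obj

instance {J : Type} [SmallCategory J] [FinCategory J] :
    (isGrMod A).IsClosedUnderLimitsOfShape J where
  limitsOfShape_le := by
    rintro M ⟨h⟩
    exact isGrMod_of_isLimit h.isLimit h.prop_diag_obj

instance : (isGrMod A).IsClosedUnderKernels where
  kernels_le := by
    rintro _ ⟨f, k, hk, hf⟩
    refine isGrMod_of_isLimit hk ?_
    rintro (_ | _)
    exacts [hf.1, hf.2]

instance : (isGrMod A).IsClosedUnderCokernels where
  cokernels_le := by
    rintro _ ⟨f, k, hk, hf⟩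
    refine isGrMod_of_isColimit hk ?_
    rintro (_ | _)
    exacts [hf.1, hf.2]

instance : (isGrMod A).IsClosedUnderFiniteProducts where
  isClosedUnderLimitsOfShape J _ := by
    have := Fintype.ofFinite J
    constructor
    rintro M ⟨h⟩
    exact isGrMod_of_isLimit h.isLimit h.prop_diag_obj

instance : (isGrMod A).IsClosedUnderIsomorphisms := inferInstance

instance : (isGrMod A).ContainsZero := inferInstance

end closure

variable (A) in
/-- The category of quasi-coherent sheaves of graded `A`-modules. -/
abbrev GrMod := (isGrMod A).FullSubcategory

instance : HasColimits (GrMod A) := ⟨fun _ _ => inferInstance⟩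


section grothendieck

instance : HasFilteredColimitsOfSize.{u, u} (GrMod A) := ⟨fun _ _ _ => inferInstance⟩

instance : PreservesFiniteLimits (isGrMod A).ι := ⟨fun _ _ _ => inferInstance⟩

instance : PreservesColimits (isGrMod A).ι := ⟨⟨inferInstance⟩⟩

instance : AB5OfSize.{u, u} (GrMod A) where
  ofShape J _ _ := HasExactColimitsOfShape.domain_of_functor J (isGrMod A).ι

/-- The formal expressions for the sections of a submodule generated by one section. -/
inductive Tm (d : Cell A) : Cell A → Type u
  | gen : Tm d d
  | zero (X : Cell A) : Tm d X
  | add {X : Cell A} : Tm d X → Tm d X → Tm d X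
  | neg {X : Cell A} : Tm d X → Tm d X
  | map {X Z : Cell A} (f : X ⟶ Z) : Tm d X → Tm d Z
  | lift (U : Y.affineOpens) (f : Γ(Y, U.1)) (i : Λ) :
      Tm d ⟨Y.affineBasicOpen f, i⟩ → Tm d ⟨U, i⟩

noncomputable def Tm.eval {d : Cell A} {M : Cell A ⥤ AddCommGrpCat.{u}} (hM : IsGrMod M)
    (m : M.obj d) : ∀ {X : Cell A}, Tm d X → M.obj X
  | _, .gen => m
  | _, .zero _ => 0
  | _, .add s t => s.eval hM m + t.eval hM m
  | _, .neg s => - s.eval hM m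
  | _, .map f s => M.map f (s.eval hM m)
  | _, .lift U f i s => (hM.qc_surj U f i (s.eval hM m)).choose_spec.choose

noncomputable def Tm.range {d : Cell A} {M : Cell A ⥤ AddCommGrpCat.{u}} (hM : IsGrMod M)
    (m : M.obj d) (X : Cell A) : AddSubgroup (M.obj X) where
  carrier := Set.range (Tm.eval hM m (X := X))
  zero_mem' := ⟨.zero X, rfl⟩
  add_mem' := by rintro _ _ ⟨s, rfl⟩ ⟨t, rfl⟩; exact ⟨.add s t, rfl⟩
  neg_mem' := by rintro _ ⟨s, rfl⟩; exact ⟨.neg s, rfl⟩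

/-- The subfunctor given by a family of subgroups stable under all the structure maps. -/
def subFunctor (M : Cell A ⥤ AddCommGrpCat.{u}) (G : ∀ X, AddSubgroup (M.obj X))
    (hG : ∀ {X Z : Cell A} (f : X ⟶ Z) (x : M.obj X), x ∈ G X → M.map f x ∈ G Z) :
    Cell A ⥤ AddCommGrpCat.{u} where
  obj X := AddCommGrpCat.of (G X)
  map {X Z} f := AddCommGrpCat.ofHom
    (((M.map f).hom.comp (G X).subtype).codRestrict (G Z) fun x => hG f x x.2)
  map_id X := by
    ext x
    exact ConcreteCategory.congr_hom (M.map_id X) x.1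
  map_comp f g := by
    ext x
    exact ConcreteCategory.congr_hom (M.map_comp f g) x.1

def subFunctorι (M : Cell A ⥤ AddCommGrpCat.{u}) (G : ∀ X, AddSubgroup (M.obj X))
    (hG : ∀ {X Z : Cell A} (f : X ⟶ Z) (x : M.obj X), x ∈ G X → M.map f x ∈ G Z) :
    subFunctor M G hG ⟶ M where
  app X := AddCommGrpCat.ofHom (G X).subtype

lemma isGrMod_subFunctor {M : Cell A ⥤ AddCommGrpCat.{u}} (hM : IsGrMod M)
    (G : ∀ X, AddSubgroup (M.obj X))
    (hG : ∀ {X Z : Cell A} (f : X ⟶ Z) (x : M.obj X), x ∈ G X → M.map f x ∈ G Z)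
    (h : ∀ (U : Y.affineOpens) (f : Γ(Y, U.1)) (i : Λ)
      (y : M.obj ⟨Y.affineBasicOpen f, i⟩), y ∈ G _ → ∃ (n : ℕ) (x : M.obj ⟨U, i⟩), x ∈ G _ ∧
      M.map (Cell.scal (Y.affineBasicOpen_le f) 1 i) x =
        M.map (Cell.scal le_rfl (rs (Y.affineBasicOpen_le f) f ^ n) i) y) :
    IsGrMod (subFunctor M G hG) where
  map_add a b c e := by
    ext x
    exact Subtype.ext (ConcreteCategory.congr_hom (hM.map_add a b c e) x.1)
  qc_surj U f i y := by
    obtain ⟨n, x, hx, e⟩ := h U f i y.1 y.2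
    exact ⟨n, ⟨x, hx⟩, Subtype.ext e⟩
  qc_inj U f i x hx := by
    obtain ⟨n, e⟩ := hM.qc_inj U f i x.1 (congrArg Subtype.val hx)
    exact ⟨n, Subtype.ext e⟩

/-- A functor structure on a family of quotients of the sets of terms. -/
structure TmModel (d : Cell A) : Type u where
  s : ∀ X, Setoid (Tm d X)
  g : ∀ X, AddCommGroup (Quotient (s X))
  m : ∀ {X Z : Cell A}, (X ⟶ Z) → (Quotient (s X) →+ Quotient (s Z))
  m_id : ∀ X, m (𝟙 X) = AddMonoidHom.id _
  m_comp : ∀ {X Z W : Cell A} (f : X ⟶ Z) (g : Z ⟶ W), m (f ≫ g) = (m g).comp (m f)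

def TmModel.functor {d : Cell A} (T : TmModel d) : Cell A ⥤ AddCommGrpCat.{u} where
  obj X := letI := T.g X; AddCommGrpCat.of (Quotient (T.s X))
  map {X Z} f := letI := T.g X; letI := T.g Z; AddCommGrpCat.ofHom (T.m f)
  map_id X := by simp only [T.m_id]; rfl
  map_comp f g := by simp only [T.m_comp]; rfl

lemma TmModel.exists_iso {d : Cell A} (N : Cell A ⥤ AddCommGrpCat.{u})
    (e : ∀ X, Tm d X → N.obj X) (he : ∀ X, Function.Surjective (e X)) :
    ∃ T : TmModel d, Nonempty (T.functor ≅ N) := by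
  let s X : Setoid (Tm d X) := Setoid.ker (e X)
  let q X : Quotient (s X) ≃ N.obj X := Setoid.quotientKerEquivOfSurjective (e X) (he X)
  let g X : AddCommGroup (Quotient (s X)) := (q X).addCommGroup
  let r X : Quotient (s X) ≃+ N.obj X := (q X).addEquiv
  refine ⟨⟨s, g, fun {X Z} f => (r Z).symm.toAddMonoidHom.comp
    ((N.map f).hom.comp (r X).toAddMonoidHom), ?_, ?_⟩, ⟨NatIso.ofComponents
      (fun X => AddEquiv.toAddCommGrpIso (X := AddCommGrpCat.of (Quotient (s X))) (r X)) ?_⟩⟩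
  · intro X
    ext x
    simp
  · intro X Z W f g
    ext x
    simp
  · intro X Z f
    ext x
    exact (r Z).apply_symm_apply _

instance : HasSeparator (GrMod A) := by
  let F (x : { p : Σ d : Cell A, TmModel d // IsGrMod p.2.functor }) : GrMod A :=
    ⟨x.1.2.functor, x.2⟩
  have : (ObjectProperty.ofObj F).IsSeparating := by
    intro M M' f g h
    ext X x
    have hM := M.property
    let G := Tm.range hM x
    have hG : ∀ {X Z : Cell A} (f : X ⟶ Z) (x : M.obj.obj X), x ∈ G X → M.obj.map f x ∈ G Z := by
      rintro X Z f _ ⟨t, rfl⟩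
      exact ⟨.map f t, rfl⟩
    have hN : IsGrMod (subFunctor M.obj G hG) := by
      refine isGrMod_subFunctor hM G hG ?_
      rintro U f i _ ⟨t, rfl⟩
      exact ⟨_, _, ⟨.lift U f i t, rfl⟩, (hM.qc_surj U f i (t.eval hM x)).choose_spec.choose_spec⟩
    obtain ⟨T, ⟨α⟩⟩ := TmModel.exists_iso (d := X) (subFunctor M.obj G hG)
      (fun Z t => ⟨t.eval hM x, t, rfl⟩) (by rintro Z ⟨_, t, rfl⟩; exact ⟨t, rfl⟩)
    have hT : IsGrMod T.functor := (isGrMod A).prop_of_iso α.symm hN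
    have := h (F ⟨⟨X, T⟩, hT⟩) ⟨_⟩ (ObjectProperty.homMk (α.hom ≫ subFunctorι M.obj G hG))
    have e := ConcreteCategory.congr_hom (congr_app (congrArg (fun t => t.hom) this) X)
      (α.inv.app X ⟨x, .gen, rfl⟩)
    have e' : (α.hom.app X) (α.inv.app X ⟨x, .gen, rfl⟩) = ⟨x, .gen, rfl⟩ :=
      ConcreteCategory.congr_hom (congr_app α.inv_hom_id X) _
    have e2 : ∀ k : M ⟶ M', ((ObjectProperty.homMk (α.hom ≫ subFunctorι M.obj G hG) :
        F ⟨⟨X, T⟩, hT⟩ ⟶ M) ≫ k).hom.app X (α.inv.app X ⟨x, .gen, rfl⟩) = k.hom.app X x := by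
      intro k
      change k.hom.app X ((subFunctorι M.obj G hG).app X
        ((α.hom.app X) (α.inv.app X ⟨x, .gen, rfl⟩))) = _
      rw [e']
      rfl
    exact (e2 f).symm.trans (e.trans (e2 g))
  have := this.isSeparator_coproduct
  exact ⟨_, this⟩

instance : IsGrothendieckAbelian.{u} (GrMod A) where

instance : (isGrMod A).ι.IsLeftAdjoint :=
  isLeftAdjoint_of_preservesColimits_of_isSeparating (isSeparator_separator (GrMod A)) _

variable (A) in
/-- The coherator: the right adjoint of the inclusion of quasi-coherent modules into presheaves
of modules on the affine open sets. -/
noncomputable def coherator : (Cell A ⥤ AddCommGrpCat.{u}) ⥤ GrMod A := (isGrMod A).ι.rightAdjoint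

end grothendieck

section structureSheaf

variable (Y) in
/-- The structure sheaf, as an algebra graded by the trivial group. -/
def structAlg : GradedAlgebra Y PUnit where
  obj U := Γ(Y, U.1)
  res h := rs h
  res_self h a := rs_self h a
  res_res {U V W} h h' a := by
    have := Y.presheaf.map_comp (homOfLE (show V.1 ≤ U.1 from h)).op
      (homOfLE (show W.1 ≤ V.1 from h')).op
    exact (ConcreteCategory.congr_hom this a).symm
  deg U _ := ⊤
  one_mem _ := trivial
  mul_mem _ _ := trivial
  isInternal U := by
    refine ⟨fun x y h => ?_, fun y => ⟨DirectSum.of _ PUnit.unit ⟨y, trivial⟩, by simp⟩⟩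
    have e : ∀ z : DirectSum PUnit (fun _ => (⊤ : AddSubgroup Γ(Y, U.1))),
        z = DirectSum.of (fun _ => (⊤ : AddSubgroup Γ(Y, U.1))) PUnit.unit (z PUnit.unit) := by
      intro z
      ext i
      simp
    rw [e x, e y] at h
    simp only [DirectSum.coeAddMonoidHom_of] at h
    rw [e x, e y, Subtype.ext h]
  res_mem _ _ _ _ := trivial
  str U := RingHom.id _
  str_mem _ _ := trivial
  res_str _ _ := rfl
  qc_surj U f y := by
    have := U.2.isLocalization_basicOpen f
    obtain ⟨⟨x, _, n, rfl⟩, e⟩ := IsLocalization.surj (Submonoid.powers f)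
      (S := Γ(Y, Y.basicOpen f)) y
    refine ⟨n, x, e.symm.trans ?_⟩
    refine (mul_comm _ _).trans ?_
    exact congrArg (· * y) (map_pow (rs (Y.affineBasicOpen_le f)) f n)
  qc_inj U f x hx := by
    have := U.2.isLocalization_basicOpen f
    obtain ⟨⟨_, n, rfl⟩, e⟩ := (IsLocalization.map_eq_zero_iff (Submonoid.powers f)
      Γ(Y, Y.basicOpen f) x).1 hx
    exact ⟨n, e⟩

variable (Y) in
/-- The category of quasi-coherent sheaves. -/
abbrev QCoh := GrMod (structAlg Y)


/-- Multiplication by the restriction of the scalar of `f` to a smaller affine open set. -/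
def Cell.act {X Z : Cell A} (f : X ⟶ Z) {W : Y.affineOpens} (h : W ≤ Z.U) :
    (⟨W, -Z.i⟩ : Cell A) ⟶ ⟨W, -X.i⟩ :=
  Cell.Hom.mk (A.res h f.val) le_rfl (by
    have e : -X.i - -Z.i = Z.i - X.i := by abel
    have : A.res h f.val ∈ A.deg W (-X.i - -Z.i) := by
      rw [e]
      exact A.res_mem h f.mem
    exact this)

lemma Cell.act_id (X : Cell A) {W : Y.affineOpens} (h : W ≤ X.U) :
    Cell.act (𝟙 X) h = 𝟙 _ := by
  ext
  simp [Cell.act]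

lemma Cell.act_comp {X Z T : Cell A} (f : X ⟶ Z) (g : Z ⟶ T) {W : Y.affineOpens} (h : W ≤ T.U) :
    Cell.act (f ≫ g) h = Cell.act g h ≫ Cell.act f (h.trans g.hle) := by
  ext
  simp [Cell.act, A.res_res, mul_comm]

lemma Cell.act_scal {X Z : Cell A} (f : X ⟶ Z) {W W' : Y.affineOpens} (h : W ≤ Z.U)
    (h' : W' ≤ W) (r : Γ(Y, W'.1)) :
    Cell.act f h ≫ Cell.scal h' r (-X.i) = Cell.scal h' r (-Z.i) ≫ Cell.act f (h'.trans h) := by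
  ext
  simp [Cell.act, A.res_res, A.res_self, mul_comm]

/-- The sections over `X.U`, of weight `X.i`, of the graded sheaf Hom from `M` to `G`: the
`O`-linear maps from the restriction of the component of `M` of weight `- X.i` to the restriction
of `G`. -/
def HomSec (M : Cell A ⥤ AddCommGrpCat.{u}) (G : Cell (structAlg Y) ⥤ AddCommGrpCat.{u})
    (X : Cell A) :
    AddSubgroup (∀ W : {W : Y.affineOpens // W ≤ X.U}, M.obj ⟨W.1, -X.i⟩ →+ G.obj ⟨W.1, ⟨⟩⟩) where
  carrier := {φ | ∀ (W W' : {W : Y.affineOpens // W ≤ X.U}) (h : W'.1 ≤ W.1) (r : Γ(Y, W'.1.1))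
    (x : M.obj ⟨W.1, -X.i⟩), φ W' (M.map (Cell.scal h r (-X.i)) x) =
      G.map (Cell.scal h r ⟨⟩) (φ W x)}
  zero_mem' := fun W W' h r x => by simp
  add_mem' := fun {φ ψ} hφ hψ W W' h r x => by
    simp [hφ W W' h r x, hψ W W' h r x]
  neg_mem' := fun {φ} hφ W W' h r x => by
    simp [hφ W W' h r x]

def HomSec.map (M : Cell A ⥤ AddCommGrpCat.{u}) (G : Cell (structAlg Y) ⥤ AddCommGrpCat.{u})
    {X Z : Cell A} (f : X ⟶ Z) : HomSec M G X →+ HomSec M G Z where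
  toFun φ := ⟨fun W => (φ.1 ⟨W.1, W.2.trans f.hle⟩).comp (M.map (Cell.act f W.2)).hom, by
    intro W W' h r x
    have e := ConcreteCategory.congr_hom (congrArg (fun t => M.map t) (Cell.act_scal f W.2 h r)) x
    have e1 := φ.2 ⟨W.1, W.2.trans f.hle⟩ ⟨W'.1, W'.2.trans f.hle⟩ h r (M.map (Cell.act f W.2) x)
    simp only [M.map_comp] at e
    exact (congrArg _ e.symm).trans e1⟩
  map_zero' := rfl
  map_add' _ _ := rfl

/-- The graded sheaf Hom, as a presheaf of graded modules on the affine open sets. -/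
def preHomObj (M : Cell A ⥤ AddCommGrpCat.{u}) (G : Cell (structAlg Y) ⥤ AddCommGrpCat.{u}) :
    Cell A ⥤ AddCommGrpCat.{u} where
  obj X := AddCommGrpCat.of (HomSec M G X)
  map f := AddCommGrpCat.ofHom (HomSec.map M G f)
  map_id X := by
    ext φ W x
    have e : M.map (Cell.act (𝟙 X) W.2) = 𝟙 _ := by rw [Cell.act_id, M.map_id]
    exact congrArg (φ.1 W) (ConcreteCategory.congr_hom e x)
  map_comp f g := by
    ext φ W x
    have e : M.map (Cell.act (f ≫ g) W.2) =
        M.map (Cell.act g W.2) ≫ M.map (Cell.act f (W.2.trans g.hle)) := by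
      rw [Cell.act_comp, M.map_comp]
    exact congrArg (φ.1 ⟨W.1, W.2.trans (f ≫ g).hle⟩) (ConcreteCategory.congr_hom e x)

def preHomMap {M M' : Cell A ⥤ AddCommGrpCat.{u}} {G G' : Cell (structAlg Y) ⥤ AddCommGrpCat.{u}}
    (α : M' ⟶ M) (β : G ⟶ G') : preHomObj M G ⟶ preHomObj M' G' where
  app X := AddCommGrpCat.ofHom
    { toFun := fun φ => ⟨fun W => ((β.app _).hom.comp (φ.1 W)).comp (α.app _).hom, by
        intro W W' h r x
        have e1 := ConcreteCategory.congr_hom (α.naturality (Cell.scal h r (-X.i))) x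
        have e2 := ConcreteCategory.congr_hom (β.naturality (Cell.scal h r ⟨⟩))
          (φ.1 W (α.app _ x))
        refine Eq.trans ?_ e2
        exact congrArg (β.app _) ((congrArg (φ.1 W') e1).trans (φ.2 W W' h r _))⟩
      map_zero' := by
        refine Subtype.ext (funext fun W => ?_)
        ext x
        exact map_zero (β.app _).hom
      map_add' := fun φ ψ => by
        refine Subtype.ext (funext fun W => ?_)
        ext x
        exact map_add (β.app _).hom _ _ }
  naturality X Z f := by
    ext φ
    refine Subtype.ext (funext fun W => AddMonoidHom.ext fun x => ?_)
    exact congrArg (fun t => β.app _ (φ.1 ⟨W.1, W.2.trans f.hle⟩ t))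
      (ConcreteCategory.congr_hom (α.naturality (Cell.act f W.2)) x).symm

/-- The internal graded Hom of quasi-coherent modules over the structure sheaf, with weight `i`
component `Hom(M_{-i}, G)`: the coherator of the graded sheaf Hom. -/
noncomputable def homQ (M : GrMod A) (G : QCoh Y) : GrMod A :=
  (coherator A).obj (preHomObj M.obj G.obj)

noncomputable def homQMap {M M' : GrMod A} {G G' : QCoh Y} (α : M' ⟶ M) (β : G ⟶ G') :
    homQ M G ⟶ homQ M' G' :=
  (coherator A).map (preHomMap α.hom β.hom)

lemma homQMap_id (M : GrMod A) (G : QCoh Y) : homQMap (𝟙 M) (𝟙 G) = 𝟙 _ :=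
  (coherator A).map_id _

lemma homQMap_comp {M M' M'' : GrMod A} {G G' G'' : QCoh Y} (α : M' ⟶ M) (β : G ⟶ G')
    (α' : M'' ⟶ M') (β' : G' ⟶ G'') :
    homQMap α β ≫ homQMap α' β' = homQMap (α' ≫ α) (β ≫ β') :=
  ((coherator A).map_comp _ _).symm

instance : (coherator A).Additive := by
  exact (Adjunction.ofIsLeftAdjoint (isGrMod A).ι).right_adjoint_additive

lemma homQMap_zero_left {M M' : GrMod A} {G G' : QCoh Y} (β : G ⟶ G') :
    homQMap (0 : M' ⟶ M) β = 0 := by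
  have : preHomMap (0 : M' ⟶ M).hom β.hom = 0 := by
    ext X φ
    refine Subtype.ext (funext fun W => AddMonoidHom.ext fun x => ?_)
    exact (congrArg (β.hom.app _) (map_zero (φ.1 W))).trans (map_zero (β.hom.app _).hom)
  rw [homQMap, this, Functor.map_zero]
  rfl

lemma homQMap_zero_right {M M' : GrMod A} {G G' : QCoh Y} (α : M' ⟶ M) :
    homQMap α (0 : G ⟶ G') = 0 := by
  have : preHomMap α.hom (0 : G ⟶ G').hom = 0 := rfl
  rw [homQMap, this, Functor.map_zero]
  rfl

end structureSheaf

section dual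

instance {J : Type} [Small.{u} J] : HasProductsOfShape J (GrMod A) :=
  hasLimitsOfShape_of_equivalence (Discrete.equivalence (equivShrink.{u} J).symm)

/-- The bidegrees contributing to the degree `n` part of a Hom complex. -/
abbrev HomIdx (n : ℤ) : Type := {x : ℤ × ℤ // x.2 = x.1 + n}

/-- The degree `n` part of the Hom complex from `M` to `J`. -/
noncomputable abbrev dualX (J : CochainComplex (QCoh Y) ℤ) (M : CochainComplex (GrMod A) ℤ)
    (n : ℤ) : GrMod A :=
  ∏ᶜ fun x : HomIdx n => homQ (M.X x.1.1) (J.X x.1.2)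

/-- The differential of the Hom complex, `φ ↦ d ∘ φ - (-1) ^ n • φ ∘ d`. -/
noncomputable def dualD (J : CochainComplex (QCoh Y) ℤ) (M : CochainComplex (GrMod A) ℤ)
    (n : ℤ) : dualX J M n ⟶ dualX J M (n + 1) :=
  Pi.lift fun x : HomIdx (n + 1) =>
    Pi.π (fun y : HomIdx n => homQ (M.X y.1.1) (J.X y.1.2))
        ⟨(x.1.1, x.1.2 - 1), by have := x.2; dsimp only; omega⟩ ≫
      homQMap (𝟙 _) (J.d (x.1.2 - 1) x.1.2) +
    (n + 1).negOnePow • (Pi.π (fun y : HomIdx n => homQ (M.X y.1.1) (J.X y.1.2))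
        ⟨(x.1.1 + 1, x.1.2), by have := x.2; dsimp only; omega⟩ ≫
      homQMap (M.d x.1.1 (x.1.1 + 1)) (𝟙 _))

lemma dualD_comp (J : CochainComplex (QCoh Y) ℤ) (M : CochainComplex (GrMod A) ℤ) (n : ℤ) :
    dualD J M n ≫ dualD J M (n + 1) = 0 := by
  refine Pi.hom_ext _ _ fun x => ?_
  simp only [dualD, Category.assoc, limit.lift_π, Fan.mk_π_app, Preadditive.comp_add,
    Linear.comp_units_smul, limit.lift_π_assoc, Preadditive.add_comp, homQMap_comp,
    Category.id_comp, Category.comp_id, HomologicalComplex.d_comp_d, zero_comp,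
    homQMap_zero_left, homQMap_zero_right, Linear.units_smul_comp, comp_zero, smul_zero,
    zero_add, add_zero]
  rw [Int.negOnePow_succ (n + 1)]
  simp

end dual

section dualizing

noncomputable instance (C : Type*) [Category* C] [Abelian C] : HasDerivedCategory C :=
  HasDerivedCategory.standard C

/-- The sections of a quasi-coherent sheaf over an affine open set, as a module. -/
abbrev secModule (G : Cell (structAlg Y) ⥤ AddCommGrpCat.{u}) (hG : IsGrMod G) (U : Y.affineOpens) :
    Module Γ(Y, U.1) (G.obj ⟨U, ⟨⟩⟩) where
  smul r x := G.map (Cell.scal le_rfl r ⟨⟩) x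
  one_smul x := map_scal_one _ _ _ x
  mul_smul r s x := by
    refine Eq.trans ?_ (map_scal_scal G le_rfl le_rfl s r ⟨⟩ x).symm
    rw [rs_self]
    rfl
  smul_zero r := map_zero (G.map (Cell.scal le_rfl r ⟨⟩)).hom
  smul_add r := map_add (G.map (Cell.scal le_rfl r ⟨⟩)).hom
  add_smul r s x := ConcreteCategory.congr_hom
    (hG.map_add (Cell.scal (U := U) le_rfl r PUnit.unit) (Cell.scal le_rfl s PUnit.unit)
      (Cell.scal le_rfl (r + s) PUnit.unit) rfl) x
  zero_smul x := by
    have h := ConcreteCategory.congr_hom (hG.map_add (Cell.scal (U := U) le_rfl 0 PUnit.unit)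
      (Cell.scal le_rfl 0 PUnit.unit) (Cell.scal le_rfl 0 PUnit.unit) (add_zero (0 : Γ(Y, U.1))).symm) x
    exact left_eq_add.1 h

/-- The functor of sections over an affine open set. -/
def sections (U : Y.affineOpens) : QCoh Y ⥤ ModuleCat.{u} Γ(Y, U.1) where
  obj G := letI := secModule G.obj G.property U; ModuleCat.of _ (G.obj.obj ⟨U, ⟨⟩⟩)
  map {G G'} α :=
    letI := secModule G.obj G.property U
    letI := secModule G'.obj G'.property U
    ModuleCat.ofHom
      { toFun := α.hom.app ⟨U, ⟨⟩⟩
        map_add' := map_add (α.hom.app ⟨U, ⟨⟩⟩).hom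
        map_smul' := fun r x => ConcreteCategory.congr_hom (α.hom.naturality _) x }

instance (U : Y.affineOpens) : (sections U).Additive where

/-- Coherence of a quasi-coherent sheaf on a (locally) Noetherian scheme. -/
def IsCoherent (G : QCoh Y) : Prop :=
  ∀ U : Y.affineOpens, Module.Finite Γ(Y, U.1) ((sections U).obj G)

/-- A bounded complex of injective quasi-coherent sheaves representing a dualizing complex: its
cohomology is coherent and, over each affine open set `U`, the canonical map from `Γ(Y, U)` to its
derived endomorphism complex is an isomorphism. -/
structure IsDualizing (J : CochainComplex (QCoh Y) ℤ) : Prop where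
  bounded : ∃ m n : ℤ, J.IsStrictlyGE m ∧ J.IsStrictlyLE n
  injective : ∀ n, Injective (J.X n)
  coherent : ∀ n, IsCoherent (J.homology n)
  endo : ∀ U : Y.affineOpens,
    letI K := DerivedCategory.Q.obj (((sections U).mapHomologicalComplex (.up ℤ)).obj J)
    Function.Bijective (fun r : Γ(Y, U.1) => (r • 𝟙 K : K ⟶ K)) ∧
      ∀ n : ℤ, n ≠ 0 → ∀ f : K ⟶ K⟦n⟧, f = 0

end dualizing

section dualFunctor

/-- The internal graded Hom complex into a fixed complex `J` of quasi-coherent sheaves. When `J` is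
a bounded complex of injectives representing a dualizing complex, this computes the dual
`RHom(M, J)`. -/
noncomputable def dual (J : CochainComplex (QCoh Y) ℤ) (M : CochainComplex (GrMod A) ℤ) :
    CochainComplex (GrMod A) ℤ :=
  CochainComplex.of (dualX J M) (dualD J M) (dualD_comp J M)

noncomputable def dualMapX (J : CochainComplex (QCoh Y) ℤ) {M M' : CochainComplex (GrMod A) ℤ}
    (f : M' ⟶ M) (n : ℤ) : dualX J M n ⟶ dualX J M' n :=
  Limits.Pi.map fun x : HomIdx n => homQMap (f.f x.1.1) (𝟙 (J.X x.1.2))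

lemma dualMapX_comm (J : CochainComplex (QCoh Y) ℤ) {M M' : CochainComplex (GrMod A) ℤ}
    (f : M' ⟶ M) (n : ℤ) :
    dualMapX J f n ≫ dualD J M' n = dualD J M n ≫ dualMapX J f (n + 1) := by
  refine Pi.hom_ext _ _ fun x => ?_
  simp [dualD, dualMapX, homQMap_comp, Preadditive.comp_add, Preadditive.add_comp,
    Linear.comp_units_smul, Linear.units_smul_comp]

/-- The (contravariant) functoriality of the Hom complex. -/
noncomputable def dualMap (J : CochainComplex (QCoh Y) ℤ) {M M' : CochainComplex (GrMod A) ℤ}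
    (f : M' ⟶ M) : dual J M ⟶ dual J M' :=
  CochainComplex.ofHom (X := dual J M) (Y := dual J M') (dualMapX J f) fun n => by
    simpa only [dual, CochainComplex.of_d] using dualMapX_comm J f n

end dualFunctor

section modules

lemma exists_homogeneous_lift (U V : Y.affineOpens) (h : V ≤ U) (i : Λ) (x : A.obj U)
    (hx : A.res h x ∈ A.deg V i) : ∃ z ∈ A.deg U i, A.res h z = A.res h x := by
  obtain ⟨z, rfl⟩ := (A.isInternal U).2 x
  let m : DirectSum Λ (fun i => A.deg U i) →+ DirectSum Λ (fun i => A.deg V i) :=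
    DirectSum.map fun i => ((A.res h).toAddMonoidHom.comp (A.deg U i).subtype).codRestrict
      (A.deg V i) fun y => A.res_mem h y.2
  have hm : ∀ w, DirectSum.coeAddMonoidHom (A.deg V) (m w) =
      A.res h (DirectSum.coeAddMonoidHom (A.deg U) w) := by
    intro w
    refine DFunLike.congr_fun (f := (DirectSum.coeAddMonoidHom (A.deg V)).comp m)
      (g := (A.res h).toAddMonoidHom.comp (DirectSum.coeAddMonoidHom (A.deg U))) ?_ w
    ext j y
    simp [m]
  have e : m z = DirectSum.of (fun i => A.deg V i) i ⟨_, hx⟩ := by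
    apply (A.isInternal V).1
    rw [hm]
    simp
  refine ⟨z i, (z i).2, ?_⟩
  have := congrArg (fun t => ((t i : A.deg V i) : A.obj V)) e
  simpa [m] using this

variable (A) in
/-- The algebra `A`, as a presheaf of graded modules over itself. -/
def selfFunctor : Cell A ⥤ AddCommGrpCat.{u} where
  obj X := AddCommGrpCat.of (A.deg X.U X.i)
  map {X Z} f := AddCommGrpCat.ofHom
    { toFun := fun x => ⟨f.val * A.res f.hle x.1, by
        have := A.mul_mem f.mem (A.res_mem f.hle x.2)
        rwa [sub_add_cancel] at this⟩
      map_zero' := by simp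
      map_add' := fun x y => by
        ext
        simp [mul_add] }
  map_id X := by
    ext x
    simp [A.res_self]
  map_comp f g := by
    ext x
    simp [A.res_res, mul_assoc]

variable (A) in
/-- The algebra `A`, as a graded module over itself. -/
def selfMod : GrMod A where
  obj := selfFunctor A
  property :=
    { map_add := fun {X Z} a b c e => by
        refine ConcreteCategory.hom_ext _ _ fun x => ?_
        have : c.val * A.res c.hle x.1 = a.val * A.res a.hle x.1 + b.val * A.res b.hle x.1 := by
          rw [e, add_mul]
        exact Subtype.ext this
      qc_surj := fun U f i y => by
        obtain ⟨n, x, e⟩ := A.qc_surj U f y.1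
        have e' : A.res (Y.affineBasicOpen_le f) x =
            A.str _ (rs (Y.affineBasicOpen_le f) f ^ n) * A.res le_rfl y.1 := by
          rw [e, A.res_str, A.res_self, map_pow]
        have hx : A.res (Y.affineBasicOpen_le f) x ∈ A.deg _ i := by
          rw [e', A.res_self]
          have := A.mul_mem (A.str_mem _ (rs (Y.affineBasicOpen_le f) f ^ n)) y.2
          rwa [zero_add] at this
        obtain ⟨z, hz, ez⟩ := exists_homogeneous_lift _ _ _ _ _ hx
        refine ⟨n, ⟨z, hz⟩, Subtype.ext ?_⟩
        refine Eq.trans ?_ (ez.trans e')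
        exact (congrArg (· * _) (map_one (A.str _))).trans (one_mul _)
      qc_inj := fun U f i x hx => by
        have hx' : A.res (Y.affineBasicOpen_le f) x.1 = 0 :=
          ((congrArg (· * _) (map_one (A.str _))).trans (one_mul _)).symm.trans
            (congrArg Subtype.val hx)
        obtain ⟨n, e⟩ := A.qc_inj U f x.1 hx'
        refine ⟨n, Subtype.ext ?_⟩
        refine Eq.trans ?_ e
        change A.str U (f ^ n) * A.res le_rfl x.1 = _
        rw [A.res_self, map_pow] }

/-- The functor on cells inducing the shift of the grading by `a`. -/
def Cell.shift (a : Λ) : Cell A ⥤ Cell A where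
  obj X := ⟨X.U, X.i + a⟩
  map f := Cell.Hom.mk f.val f.hle (by simpa using f.mem)

/-- The graded module `M(a)`, with `M(a)_i = M_{i + a}`. -/
def twist (a : Λ) : GrMod A ⥤ GrMod A where
  obj M :=
    { obj := Cell.shift a ⋙ M.obj
      property :=
        { map_add := fun {X Z} p q r e => M.property.map_add _ _ _ e
          qc_surj := fun U f i y => M.property.qc_surj U f (i + a) y
          qc_inj := fun U f i x hx => M.property.qc_inj U f (i + a) x hx } }
  map α := ObjectProperty.homMk (Functor.whiskerLeft (Cell.shift a) α.hom)

instance (a : Λ) : (twist (A := A) a).Additive where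

variable (A) in
/-- The functor on cells inducing the weight `i` component. -/
def Cell.emb (i : Λ) : Cell (structAlg Y) ⥤ Cell A where
  obj X := ⟨X.U, i⟩
  map f := Cell.scal f.hle f.val i
  map_id X := by
    ext
    exact map_one (A.str X.U)
  map_comp {X Z W} f g := by
    refine Eq.trans ?_ (Cell.scal_comp f.hle g.hle f.val g.val i).symm
    rfl

/-- The weight `i` component of a graded module. -/
def weight (i : Λ) : GrMod A ⥤ QCoh Y where
  obj M :=
    { obj := Cell.emb A i ⋙ M.obj
      property :=
        { map_add := fun {X Z} p q r e => M.property.map_add _ _ _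
            ((congrArg (A.str Z.U) e).trans (map_add (A.str Z.U) _ _))
          qc_surj := fun U f _ y => M.property.qc_surj U f i y
          qc_inj := fun U f _ x hx => M.property.qc_inj U f i x hx } }
  map α := ObjectProperty.homMk (Functor.whiskerLeft (Cell.emb A i) α.hom)

instance (i : Λ) : (weight (A := A) i).Additive where

end modules

section torsion

variable (A) in
/-- The graded ideal of `A` over `U` generated by the elements whose degree lies in `S`. -/
def degIdeal (S : Set Λ) (U : Y.affineOpens) : Ideal (A.obj U) :=
  Ideal.span (⋃ i ∈ S, (A.deg U i : Set (A.obj U)))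

/-- The torsion sections, i.e. those killed by a power of the ideal generated by the elements
whose degree lies in `S`. -/
def torsSec (S : Set Λ) (M : Cell A ⥤ AddCommGrpCat.{u}) (X : Cell A) :
    AddSubgroup (M.obj X) where
  carrier := {m | ∃ n : ℕ, ∀ (Z : Cell A) (f : X ⟶ Z), f.val ∈ degIdeal A S Z.U ^ n →
    M.map f m = 0}
  zero_mem' := ⟨0, fun Z f _ => map_zero (M.map f).hom⟩
  add_mem' := by
    rintro x y ⟨n, hx⟩ ⟨k, hy⟩
    refine ⟨max n k, fun Z f hf => ?_⟩
    rw [map_add, hx Z f (Ideal.pow_le_pow_right (le_max_left n k) hf),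
      hy Z f (Ideal.pow_le_pow_right (le_max_right n k) hf), add_zero]
  neg_mem' := by
    rintro x ⟨n, hx⟩
    refine ⟨n, fun Z f hf => ?_⟩
    rw [map_neg, hx Z f hf, neg_zero]

lemma torsSec_map (S : Set Λ) (M : Cell A ⥤ AddCommGrpCat.{u}) {X Z : Cell A} (f : X ⟶ Z)
    (x : M.obj X) (hx : x ∈ torsSec S M X) : M.map f x ∈ torsSec S M Z := by
  obtain ⟨n, h⟩ := hx
  refine ⟨n, fun W g hg => ?_⟩
  refine (ConcreteCategory.congr_hom (M.map_comp f g) x).symm.trans (h W (f ≫ g) ?_)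
  exact Ideal.mul_mem_right _ _ hg

/-- The presheaf of torsion sections. -/
def torsPre (S : Set Λ) : GrMod A ⥤ (Cell A ⥤ AddCommGrpCat.{u}) where
  obj M := subFunctor M.obj (torsSec S M.obj) fun f x hx => torsSec_map S M.obj f x hx
  map {M M'} α :=
    { app := fun X => AddCommGrpCat.ofHom
        (((α.hom.app X).hom.comp (torsSec S M.obj X).subtype).codRestrict (torsSec S M'.obj X)
          fun x => by
            obtain ⟨n, h⟩ := x.2
            refine ⟨n, fun Z f hf => ?_⟩
            refine (ConcreteCategory.congr_hom (α.hom.naturality f) x.1).symm.trans ?_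
            exact (congrArg (α.hom.app Z) (h Z f hf)).trans (map_zero (α.hom.app Z).hom))
      naturality := fun X Z f => by
        refine ConcreteCategory.hom_ext _ _ fun x => Subtype.ext ?_
        exact ConcreteCategory.congr_hom (α.hom.naturality f) x.1 }

instance (S : Set Λ) : (torsPre (A := A) S).Additive where

/-- The inclusion of the presheaf of torsion sections. -/
def torsPreι (S : Set Λ) : torsPre (A := A) S ⟶ (isGrMod A).ι where
  app M := subFunctorι M.obj (torsSec S M.obj) fun f x hx => torsSec_map S M.obj f x hx

/-- The functor `M ↦ Γ_I(M)`, the quasi-coherent submodule of torsion sections, where `I` is the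
ideal generated by the elements whose degree lies in `S`. -/
noncomputable def Γtors (S : Set Λ) : GrMod A ⥤ GrMod A := torsPre S ⋙ coherator A

instance (S : Set Λ) : (Γtors (A := A) S).Additive := by
  unfold Γtors
  infer_instance

/-- The inclusion `Γ_I(M) ⟶ M`. -/
noncomputable def Γtorsι (S : Set Λ) : Γtors (A := A) S ⟶ 𝟭 (GrMod A) where
  app M := ObjectProperty.homMk
    ((Adjunction.ofIsLeftAdjoint (isGrMod A).ι).counit.app ((torsPre S).obj M) ≫
      (torsPreι S).app M)
  naturality M M' α := by
    refine ObjectProperty.hom_ext _ ?_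
    have h1 := (Adjunction.ofIsLeftAdjoint (isGrMod A).ι).counit.naturality ((torsPre S).map α)
    have h2 := (torsPreι S).naturality α
    have h3 := congrArg (· ≫ (torsPreι S).app M') h1
    simp only [Category.assoc, Functor.id_map] at h3
    rw [h2, ← Category.assoc] at h3
    simp only [← Category.assoc] at h3
    exact h3

variable (A) in
/-- An injective resolution of `A` in the category of graded modules. -/
noncomputable def resol : CochainComplex (GrMod A) ℤ :=
  (injectiveResolution (selfMod A)).cochainComplex

variable (A) in
/-- The algebra `A`, as a complex of graded modules concentrated in degree zero. -/
noncomputable def selfCpx : CochainComplex (GrMod A) ℤ :=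
  (CochainComplex.singleFunctor (GrMod A) 0).obj (selfMod A)

variable (A) in
/-- The local cohomology complex of `A`, for the ideal generated by the elements whose degree lies
in `S`: the torsion functor applied to an injective resolution of `A`. -/
noncomputable def RΓ (S : Set Λ) : CochainComplex (GrMod A) ℤ :=
  ((Γtors S).mapHomologicalComplex (.up ℤ)).obj (resol A)

variable (A) in
noncomputable def RΓι (S : Set Λ) : RΓ A S ⟶ resol A where
  f _ := (Γtorsι S).app _
  comm' _ _ _ := ((Γtorsι S).naturality _).symm

variable (A) in
/-- The Čech complex of `A`: the cofiber of the map from the local cohomology complex to (an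
injective resolution of) `A`. -/
noncomputable def cech (S : Set Λ) : CochainComplex (GrMod A) ℤ := cokernel (RΓι A S)

variable (A) in
/-- The canonical map from `A` to its Čech complex. -/
noncomputable def eta (S : Set Λ) : selfCpx A ⟶ cech A S :=
  (injectiveResolution (selfMod A)).ι' ≫ cokernel.π (RΓι A S)

end torsion

section flips

/-- The shift of the grading of a complex. -/
noncomputable abbrev twistCpx (a : Λ) :
    CochainComplex (GrMod A) ℤ ⥤ CochainComplex (GrMod A) ℤ :=
  (twist a).mapHomologicalComplex (.up ℤ)

/-- The vanishing in weight `i` of an object of the derived category. -/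
def IsZeroInWeight (i : Λ) (K : DerivedCategory (GrMod A)) : Prop :=
  ∀ n : ℤ, IsZero ((weight i).obj ((DerivedCategory.homologyFunctor (GrMod A) n).obj K))

/-- A morphism of the derived category is a quasi-isomorphism in weight `i`. -/
def QuasiIsoInWeight (i : Λ) {K L : DerivedCategory (GrMod A)} (φ : K ⟶ L) : Prop :=
  ∀ n : ℤ, IsIso ((weight i).map ((DerivedCategory.homologyFunctor (GrMod A) n).map φ))

open DerivedCategory in
/-- A homological flip (if `0 < a`) or a homological flop (if `a = 0`) over `Y`. The ideals
involved are those generated by the elements of positive, resp. negative, degree. -/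
structure HomologicalFlipFlop (Y : Scheme.{u}) where
  ω : CochainComplex (QCoh Y) ℤ
  isDualizing : IsDualizing ω
  A : GradedAlgebra Y ℤ
  isNoetherianRing : ∀ U, IsNoetherianRing (A.obj U)
  isCoherent : IsCoherent ((weight 0).obj (selfMod A))
  a : ℤ
  a_nonneg : 0 ≤ a
  Φpos : Q.obj ((twistCpx a).obj (cech A (Set.Ioi 0))) ⟶ Q.obj (dual ω (cech A (Set.Ioi 0)))
  Φneg : Q.obj ((twistCpx a).obj (cech A (Set.Iio 0))) ⟶ Q.obj (dual ω (cech A (Set.Iio 0)))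
  compat : Q.map ((twistCpx a).map (eta A (Set.Ioi 0))) ≫ Φpos ≫
      Q.map (dualMap ω (eta A (Set.Ioi 0))) =
    Q.map ((twistCpx a).map (eta A (Set.Iio 0))) ≫ Φneg ≫
      Q.map (dualMap ω (eta A (Set.Iio 0)))
  quasiIso_pos : ∀ i, QuasiIsoInWeight i Φpos
  quasiIso_neg : ∀ i, QuasiIsoInWeight i Φneg

end flips

end HFF

/-!
Write `C⁺`, `C⁻` for the Čech complexes of `A` and `R⁺`, `R⁻` for its local cohomology complexes
with respect to `I⁺` and `I⁻`, and `D` for the duality functor. Rotating the twisted local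
cohomology triangle of `I⁺` and dualizing that of `I⁻` gives the distinguished triangles
`A(a) ⟶ C⁺(a) ⟶ R⁺(a)[1]` and `D(C⁻) ⟶ D(A) ⟶ D(R⁻)`. By compatibility, `η⁻(a)` followed by `Φ⁻`
and `Φ⁺` followed by `D(η⁺)` are the vertical maps of a commutative square between their first
arrows, and `Ψ` completes it to a morphism of triangles. In a weight in which `R⁺(a)` and `D(R⁻)`
vanish, `Ψ` is trivially a quasi-isomorphism; in a weight in which `R⁻(a)` and `D(R⁺)` vanish, so
are the two vertical maps of the square, and hence `Ψ`.

That `D` is exact, and turns vanishing in weight `-i` into vanishing in weight `i`, is elementary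
for internal Homs into an injective quasi-coherent sheaf on an affine scheme. An injective on a
compact separated scheme is a direct summand of a finite sum of direct images of injectives from
affine opens, and the internal Hom into a direct image is the direct image of an internal Hom.
-/

namespace HFF

variable {Y : Scheme.{u}} {Λ : Type} [AddCommGroup Λ] [DecidableEq Λ]

section opens
variable {U : Y.Opens}

/-- An affine open subset of the open subscheme `U`, as an affine open subset of `Y`. -/
def imageOpen (W : U.toScheme.affineOpens) : Y.affineOpens :=
  ⟨U.ι ''ᵁ W.1, W.2.image_of_isOpenImmersion U.ι⟩

lemma imageOpen_mono {V W : U.toScheme.affineOpens} (h : V ≤ W) : imageOpen V ≤ imageOpen W :=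
  U.ι.image_mono h

lemma imageOpen_affineBasicOpen (W : U.toScheme.affineOpens) (f : Γ(Y, (imageOpen W).1)) :
    imageOpen (U.toScheme.affineBasicOpen (U := W) f) = Y.affineBasicOpen f :=
  Subtype.ext <| (Scheme.image_basicOpen U.ι (U := W.1) f).trans <| by
    rw [Scheme.Opens.ι_appIso]
    rfl

/-- The intersection of an affine open subset of `Y` with `U`, as an affine open subset of the open
subscheme `U`. -/
def preimageOpen (U : Y.Opens) [IsAffineHom U.ι] (V : Y.affineOpens) : U.toScheme.affineOpens :=
  ⟨U.ι ⁻¹ᵁ V.1, V.2.preimage U.ι⟩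

variable [IsAffineHom U.ι]

lemma preimageOpen_mono {V W : Y.affineOpens} (h : V ≤ W) : preimageOpen U V ≤ preimageOpen U W :=
  U.ι.preimage_mono h

lemma imageOpen_le_iff {W : U.toScheme.affineOpens} {V : Y.affineOpens} :
    imageOpen W ≤ V ↔ W ≤ preimageOpen U V :=
  ⟨fun h x hx => h ⟨x, hx, rfl⟩, fun h => by rintro _ ⟨x, hx, rfl⟩; exact h hx⟩

lemma imageOpen_preimageOpen_le (V : Y.affineOpens) : imageOpen (preimageOpen U V) ≤ V :=
  imageOpen_le_iff.2 le_rfl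

lemma preimageOpen_affineBasicOpen (V : Y.affineOpens) (f : Γ(Y, V.1)) :
    preimageOpen U (Y.affineBasicOpen f) =
      U.toScheme.affineBasicOpen (U := preimageOpen U V) (rs (imageOpen_preimageOpen_le V) f) :=
  Subtype.ext (U.ι.preimage_basicOpen f)

end opens

namespace GradedAlgebra
variable (A : GradedAlgebra Y Λ)

lemma exists_res_eq_of_eq {U V : Y.affineOpens} {f : Γ(Y, U.1)} (e : V = Y.affineBasicOpen f)
    (h : V ≤ U) (y : A.obj V) :
    ∃ (n : ℕ) (x : A.obj U), A.res h x = A.res h (A.str U f) ^ n * y := by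
  subst e
  exact A.qc_surj U f y

lemma exists_pow_mul_eq_zero_of_eq {U V : Y.affineOpens} {f : Γ(Y, U.1)}
    (e : V = Y.affineBasicOpen f) (h : V ≤ U) (x : A.obj U) (hx : A.res h x = 0) :
    ∃ n : ℕ, A.str U f ^ n * x = 0 := by
  subst e
  exact A.qc_inj U f x hx

/-- The restriction of a graded algebra to an open subscheme. -/
def restrict (U : Y.Opens) : GradedAlgebra U.toScheme Λ where
  obj W := A.obj (imageOpen W)
  res h := A.res (imageOpen_mono h)
  res_self _ := A.res_self _
  res_res _ _ := A.res_res _ _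
  deg W := A.deg (imageOpen W)
  one_mem _ := A.one_mem _
  mul_mem := A.mul_mem
  isInternal _ := A.isInternal _
  res_mem _ := A.res_mem _
  str W := A.str (imageOpen W)
  str_mem W r := A.str_mem (imageOpen W) r
  res_str h r := A.res_str (imageOpen_mono h) r
  qc_surj W f := A.exists_res_eq_of_eq (imageOpen_affineBasicOpen W f) _
  qc_inj W f := A.exists_pow_mul_eq_zero_of_eq (imageOpen_affineBasicOpen W f) _

end GradedAlgebra

namespace IsGrMod
variable {A : GradedAlgebra Y Λ} {M : Cell A ⥤ AddCommGrpCat.{u}}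

lemma exists_map_scal_eq_of_eq (hM : IsGrMod M) {U V : Y.affineOpens} {f : Γ(Y, U.1)}
    (e : V = Y.affineBasicOpen f) (h : V ≤ U) (i : Λ) (y : M.obj ⟨V, i⟩) :
    ∃ (n : ℕ) (x : M.obj ⟨U, i⟩),
      M.map (Cell.scal h 1 i) x = M.map (Cell.scal le_rfl (rs h f ^ n) i) y := by
  subst e
  exact hM.qc_surj U f i y

lemma exists_map_scal_pow_eq_zero_of_eq (hM : IsGrMod M) {U V : Y.affineOpens} {f : Γ(Y, U.1)}
    (e : V = Y.affineBasicOpen f) (h : V ≤ U) (i : Λ) (x : M.obj ⟨U, i⟩)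
    (hx : M.map (Cell.scal h 1 i) x = 0) : ∃ n : ℕ, M.map (Cell.scal le_rfl (f ^ n) i) x = 0 := by
  subst e
  exact hM.qc_inj U f i x hx

end IsGrMod

namespace Cell
variable (A : GradedAlgebra Y Λ) (U : Y.Opens)

/-- The functor on cells along which modules are restricted to the open subscheme `U`. -/
def image : Cell (A.restrict U) ⥤ Cell A where
  obj X := ⟨imageOpen X.U, X.i⟩
  map f := Hom.mk f.val (imageOpen_mono f.hle) f.mem

variable [IsAffineHom U.ι]

/-- The functor on cells along which modules are pushed forward from the open subscheme `U`. -/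
def preimage : Cell A ⥤ Cell (A.restrict U) where
  obj X := ⟨preimageOpen U X.U, X.i⟩
  map {_ Z} f := Hom.mk (A.res (imageOpen_preimageOpen_le Z.U) f.val) (preimageOpen_mono f.hle)
    (A.res_mem _ f.mem)
  map_id _ := Hom.ext (map_one _)
  map_comp f g := Hom.ext <| by
    change A.res _ (g.val * A.res _ f.val) =
      A.res _ g.val * A.res (imageOpen_mono (preimageOpen_mono g.hle)) (A.res _ f.val)
    rw [map_mul, A.res_res, A.res_res]
    rfl

lemma preimage_scal {V W : Y.affineOpens} (h : W ≤ V) (r : Γ(Y, W.1)) (i : Λ) :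
    (preimage A U).map (scal h r i) =
      scal (A := A.restrict U) (preimageOpen_mono h) (rs (imageOpen_preimageOpen_le W) r) i :=
  hom_ext (A.res_str _ _)

/-- The adjunction reflecting that `imageOpen` is left adjoint to `preimageOpen`. -/
def preimageAdjImage : preimage A U ⊣ image A U :=
  Adjunction.mkOfHomEquiv
    { homEquiv X Z :=
        { toFun f := Hom.mk f.val (imageOpen_le_iff.2 f.hle) f.mem
          invFun f := Hom.mk f.val (imageOpen_le_iff.1 f.hle) f.mem }
      homEquiv_naturality_left_symm f g :=
        Hom.ext (congrArg (g.val * ·) (A.res_res _ _ _).symm)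
      homEquiv_naturality_right _ _ := rfl }

end Cell

section push
variable (A : GradedAlgebra Y Λ) (U : Y.Opens)

/-- The restriction of graded modules to an open subscheme. -/
def restrict : GrMod A ⥤ GrMod (A.restrict U) where
  obj M :=
    { obj := Cell.image A U ⋙ M.obj
      property :=
        { map_add a b c e := M.property.map_add _ _ _ e
          qc_surj W f i :=
            M.property.exists_map_scal_eq_of_eq (imageOpen_affineBasicOpen W f) _ i
          qc_inj W f i :=
            M.property.exists_map_scal_pow_eq_zero_of_eq (imageOpen_affineBasicOpen W f) _ i } }
  map α := ObjectProperty.homMk (Functor.whiskerLeft (Cell.image A U) α.hom)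

variable [IsAffineHom U.ι]

/-- The direct image of graded modules from an open subscheme. -/
def push : GrMod (A.restrict U) ⥤ GrMod A where
  obj M :=
    { obj := Cell.preimage A U ⋙ M.obj
      property :=
        { map_add a b c e := M.property.map_add _ _ _
            ((congrArg (A.res _) e).trans (map_add (A.res _) _ _))
          qc_surj V f i y := by
            have hf := Y.affineBasicOpen_le f
            obtain ⟨n, x, e⟩ := M.property.exists_map_scal_eq_of_eq
              (preimageOpen_affineBasicOpen V f) (preimageOpen_mono hf) i y
            refine ⟨n, x, ?_⟩
            simp only [Functor.comp_map, Cell.preimage_scal, map_one, map_pow]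
            have hrs : rs (Y := U.toScheme) (preimageOpen_mono hf)
                (rs (imageOpen_preimageOpen_le V) f) =
                  rs (imageOpen_preimageOpen_le (Y.affineBasicOpen f)) (rs hf f) :=
              ((structAlg Y).res_res (imageOpen_preimageOpen_le V)
                (imageOpen_mono (preimageOpen_mono hf)) f).trans
                  ((structAlg Y).res_res hf (imageOpen_preimageOpen_le _) f).symm
            rw [hrs] at e
            exact e
          qc_inj V f i x hx := by
            simp only [Functor.comp_map, Cell.preimage_scal, map_one] at hx
            obtain ⟨n, e⟩ := M.property.exists_map_scal_pow_eq_zero_of_eq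
              (preimageOpen_affineBasicOpen V f) (preimageOpen_mono (Y.affineBasicOpen_le f)) i x hx
            refine ⟨n, ?_⟩
            simp only [Functor.comp_map, Cell.preimage_scal, map_pow]
            exact e } }
  map α := ObjectProperty.homMk (Functor.whiskerLeft (Cell.preimage A U) α.hom)

/-- The adjunction between restriction and direct image, for presheaves of graded modules. -/
def presheafRestrictAdjPush : (Functor.whiskeringLeft _ _ AddCommGrpCat.{u}).obj (Cell.image A U) ⊣
    (Functor.whiskeringLeft _ _ _).obj (Cell.preimage A U) :=
  (Cell.preimageAdjImage A U).whiskerLeft _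

/-- The adjunction between restriction and direct image, for graded modules. -/
noncomputable def restrictAdjPush : restrict A U ⊣ push A U :=
  (presheafRestrictAdjPush A U).restrictFullyFaithful (isGrMod A).fullyFaithfulι
    (isGrMod _).fullyFaithfulι (Iso.refl _) (Iso.refl _)

/-- The coherator commutes with direct images, since restriction commutes with the inclusion of
modules into presheaves. -/
noncomputable def coheratorPushIso :
    (Functor.whiskeringLeft _ _ _).obj (Cell.preimage A U) ⋙ coherator A ≅
      coherator (A.restrict U) ⋙ push A U :=
  ((Adjunction.ofIsLeftAdjoint (isGrMod A).ι).comp (presheafRestrictAdjPush A U)).rightAdjointUniq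
    (((restrictAdjPush A U).comp
      (Adjunction.ofIsLeftAdjoint (isGrMod (A.restrict U)).ι)).ofNatIsoLeft (Iso.refl _))

end push

section secAt
variable {A : GradedAlgebra Y Λ}

/-- The functor of sections of graded modules over a cell. -/
noncomputable abbrev secAt (X : Cell A) : GrMod A ⥤ AddCommGrpCat.{u} :=
  (isGrMod A).ι ⋙ evFunctor A X

lemma isZero_iff_secAt (M : GrMod A) : IsZero M ↔ ∀ X, IsZero ((secAt X).obj M) := by
  refine ⟨fun h X => (secAt X).map_isZero h, fun h => ?_⟩
  rw [IsZero.iff_id_eq_zero]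
  ext X x
  have : Subsingleton (M.obj.obj X) := AddCommGrpCat.subsingleton_of_isZero (h X)
  exact Subsingleton.elim _ _

lemma exact_iff_secAt (S : ShortComplex (GrMod A)) :
    S.Exact ↔ ∀ X, (S.map (secAt X)).Exact := by
  simp only [ShortComplex.exact_iff_isZero_homology, isZero_iff_secAt S.homology]
  exact forall_congr' fun X => (S.mapHomologyIso (secAt X)).symm.isZero_iff

lemma exact_weight_iff (S : ShortComplex (GrMod A)) (i : Λ) :
    (S.map (weight i)).Exact ↔ ∀ U, (S.map (secAt ⟨U, i⟩)).Exact :=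
  (exact_iff_secAt _).trans ⟨fun h U => h ⟨U, ⟨⟩⟩, fun h X => h X.U⟩

lemma isZero_weight_iff (M : GrMod A) (i : Λ) :
    IsZero ((weight i).obj M) ↔ ∀ U, IsZero ((secAt ⟨U, i⟩).obj M) :=
  (isZero_iff_secAt _).trans ⟨fun h U => h ⟨U, ⟨⟩⟩, fun h X => h X.U⟩

lemma eq_zero_of_locally_eq_zero (M : GrMod A) {V : Y.affineOpens} {i : Λ} (x : M.obj.obj ⟨V, i⟩)
    (h : ∀ y ∈ V.1, ∃ (W : Y.affineOpens) (hW : W ≤ V),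
      y ∈ W.1 ∧ M.obj.map (Cell.scal hW 1 i) x = 0) : x = 0 := by
  let s : Set Γ(Y, V.1) := {f | M.obj.map (Cell.scal (Y.affineBasicOpen_le f) 1 i) x = 0}
  have hs : Ideal.span s = ⊤ := by
    rw [← V.2.self_le_iSup_basicOpen_iff]
    intro y hy
    obtain ⟨W, hW, hyW, hx⟩ := h y hy
    obtain ⟨f, hf, hyf⟩ := V.2.exists_basicOpen_le ⟨y, hyW⟩ hy
    refine TopologicalSpace.Opens.mem_iSup.2 ⟨⟨f, ?_⟩, hyf⟩
    have e := map_scal_scal M.obj hW (show Y.affineBasicOpen f ≤ W from hf) 1 1 i x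
    rw [hx, map_zero, map_one, one_mul] at e
    exact e.symm
  let : Module Γ(Y, V.1) (M.obj.obj ⟨V, i⟩) :=
    secModule ((weight i).obj M).obj ((weight i).obj M).property V
  exact (Submodule.mem_bot Γ(Y, V.1)).1 <|
    Submodule.mem_of_span_eq_top_of_smul_pow_mem (M := M.obj.obj ⟨V, i⟩) ⊥ s hs x
      fun f => (M.property.qc_inj V f i x f.2).imp fun _ hn => (Submodule.mem_bot _).2 hn

end secAt

section internalHom
variable (A : GradedAlgebra Y Λ)

/-- The graded sheaf Hom, before applying the coherator, as a bifunctor. -/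
def preHom : QCoh Y ⥤ (GrMod A)ᵒᵖ ⥤ Cell A ⥤ AddCommGrpCat.{u} where
  obj G :=
    { obj M := preHomObj M.unop.obj G.obj
      map α := preHomMap α.unop.hom (𝟙 G.obj) }
  map β := { app M := preHomMap (𝟙 M.unop.obj) β.hom }

/-- The internal Hom `homQ` as a bifunctor. -/
noncomputable def internalHom : QCoh Y ⥤ (GrMod A)ᵒᵖ ⥤ GrMod A :=
  preHom A ⋙ (Functor.whiskeringRight _ _ _).obj (coherator A)

instance (G : QCoh Y) : ((preHom A).obj G).Additive where
  map_add {_ _ α β} := by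
    ext X φ
    exact Subtype.ext (funext fun W => AddMonoidHom.ext fun x =>
      map_add (φ.1 W) (α.unop.hom.app _ x) (β.unop.hom.app _ x))

instance : (preHom A).Additive where

instance (G : QCoh Y) : ((internalHom A).obj G).Additive :=
  inferInstanceAs ((preHom A).obj G ⋙ coherator A).Additive

instance : (internalHom A).Additive where
  map_add {_ _ β γ} := by
    ext1
    ext1 M
    change (coherator A).map (((preHom A).map (β + γ)).app M) = _
    rw [Functor.map_add, NatTrans.app_add, Functor.map_add]
    rfl

variable {A} in
lemma isAdd_preHom (I : QCoh Y) (M : (GrMod A)ᵒᵖ) : isAdd A (((preHom A).obj I).obj M) := by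
  intro Z T a b c h
  ext φ
  refine Subtype.ext (funext fun W => AddMonoidHom.ext fun x => ?_)
  have e := M.unop.property.map_add (Cell.act a W.2) (Cell.act b W.2) (Cell.act c W.2)
    ((congrArg (A.res W.2) h).trans (map_add _ _ _))
  exact (congrArg (φ.1 ⟨W.1, W.2.trans c.hle⟩) (ConcreteCategory.congr_hom e x)).trans
    (map_add (φ.1 ⟨W.1, W.2.trans c.hle⟩) _ _)

variable (U : Y.Opens) [IsAffineHom U.ι]

lemma Cell.preimageAdjImage_unit_app (V : Y.affineOpens) (i : Λ) :
    (preimageAdjImage A U).unit.app ⟨V, i⟩ = scal (imageOpen_preimageOpen_le V) 1 i :=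
  hom_ext (map_one (A.str (imageOpen (preimageOpen U V)))).symm

lemma Cell.preimageAdjImage_counit_app (W : U.toScheme.affineOpens) (i : Λ) :
    (preimageAdjImage A U).counit.app ⟨W, i⟩ = scal (imageOpen_le_iff.1 le_rfl) 1 i :=
  hom_ext (map_one (A.str (imageOpen W))).symm

variable {A} in
lemma HomSec.map_of_eq_scal {M : Cell A ⥤ AddCommGrpCat.{u}}
    {G : Cell (structAlg Y) ⥤ AddCommGrpCat.{u}} {X : Cell A} (φ : HomSec M G X)
    {W W' : {W : Y.affineOpens // W ≤ X.U}} {h : W'.1 ≤ W.1} {r : Γ(Y, W'.1.1)}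
    {f : (⟨W.1, -X.i⟩ : Cell A) ⟶ ⟨W'.1, -X.i⟩}
    {g : (⟨W.1, ⟨⟩⟩ : Cell (structAlg Y)) ⟶ ⟨W'.1, ⟨⟩⟩} (hf : f = Cell.scal h r (-X.i))
    (hg : g = Cell.scal h r PUnit.unit) (x : M.obj ⟨W.1, -X.i⟩) :
    φ.1 W' (M.map f x) = G.map g (φ.1 W x) := by
  subst hf hg
  exact φ.2 W W' h r x

/-- Local morphisms into a direct image are local morphisms from the restriction. -/
def homSecPushEquiv (M : GrMod A) (I : QCoh U.toScheme) (X : Cell A) :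
    HomSec M.obj ((push (structAlg Y) U).obj I).obj X ≃+
      HomSec ((restrict A U).obj M).obj I.obj ((Cell.preimage A U).obj X) where
  toFun φ := ⟨fun W =>
    (I.obj.map ((Cell.preimageAdjImage (structAlg Y) U).counit.app ⟨W.1, ⟨⟩⟩)).hom.comp
      (φ.1 ⟨imageOpen W.1, imageOpen_le_iff.2 W.2⟩), fun W W' h r x => by
    have e := φ.2 ⟨imageOpen W.1, imageOpen_le_iff.2 W.2⟩ ⟨imageOpen W'.1, imageOpen_le_iff.2 W'.2⟩
      (imageOpen_mono h) r x
    exact (congrArg (I.obj.map _).hom e).trans (ConcreteCategory.congr_hom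
      ((Functor.whiskerRight (Cell.preimageAdjImage (structAlg Y) U).counit I.obj).naturality
        (Cell.scal h r ⟨⟩)) _)⟩
  invFun ψ := ⟨fun W =>
    (ψ.1 ⟨preimageOpen U W.1, preimageOpen_mono W.2⟩).comp
      (M.obj.map ((Cell.preimageAdjImage A U).unit.app ⟨W.1, -X.i⟩)).hom, fun W W' h r x => by
    have e := ConcreteCategory.congr_hom
      ((Functor.whiskerRight (Cell.preimageAdjImage A U).unit M.obj).naturality
        (Cell.scal h r (-X.i))) x
    refine (congrArg _ e).trans ?_
    exact HomSec.map_of_eq_scal ψ (W := ⟨preimageOpen U W.1, preimageOpen_mono W.2⟩)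
      (W' := ⟨preimageOpen U W'.1, preimageOpen_mono W'.2⟩) (Cell.preimage_scal A U h r (-X.i))
      (Cell.preimage_scal (structAlg Y) U h r ⟨⟩) _⟩
  left_inv φ := by
    refine Subtype.ext (funext fun W => AddMonoidHom.ext fun x => ?_)
    have e := HomSec.map_of_eq_scal φ (W' := ⟨_, (imageOpen_preimageOpen_le W.1).trans W.2⟩)
      (Cell.preimageAdjImage_unit_app A U W.1 (-X.i))
      (Cell.preimageAdjImage_unit_app (structAlg Y) U W.1 ⟨⟩) x
    refine (congrArg (I.obj.map _).hom e).trans ?_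
    exact ConcreteCategory.congr_hom ((I.obj.map_comp _ _).symm.trans
      ((congrArg (I.obj.map ·) ((Cell.preimageAdjImage (structAlg Y) U).left_triangle_components
        ⟨W.1, ⟨⟩⟩)).trans (I.obj.map_id _))) (φ.1 W x)
  right_inv ψ := by
    refine Subtype.ext (funext fun W => AddMonoidHom.ext fun x => ?_)
    have e := HomSec.map_of_eq_scal ψ
      (W := ⟨preimageOpen U (imageOpen W.1), preimageOpen_mono (imageOpen_le_iff.2 W.2)⟩)
      (Cell.preimageAdjImage_counit_app A U W.1 (-X.i))
      (Cell.preimageAdjImage_counit_app (structAlg Y) U W.1 ⟨⟩)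
      (M.obj.map ((Cell.preimageAdjImage A U).unit.app ⟨imageOpen W.1, -X.i⟩) x)
    refine e.symm.trans (congrArg (ψ.1 W) ?_)
    exact ConcreteCategory.congr_hom ((M.obj.map_comp _ _).symm.trans
      ((congrArg (M.obj.map ·) ((Cell.preimageAdjImage A U).right_triangle_components
        ⟨W.1, -X.i⟩)).trans (M.obj.map_id _))) x
  map_add' φ ψ := by
    refine Subtype.ext (funext fun W => AddMonoidHom.ext fun x => ?_)
    exact map_add (I.obj.map _).hom _ _

/-- Local morphisms into a direct image are the direct image of the local morphisms from the
restriction. -/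
def preHomPushIso (I : QCoh U.toScheme) :
    (preHom A).obj ((push (structAlg Y) U).obj I) ≅
      (restrict A U).op ⋙ (preHom (A.restrict U)).obj I ⋙
        (Functor.whiskeringLeft _ _ _).obj (Cell.preimage A U) :=
  NatIso.ofComponents (fun M => NatIso.ofComponents
    (fun X => (homSecPushEquiv A U M.unop I X).toAddCommGrpIso) fun {X Z} f => by
      ext φ
      refine Subtype.ext (funext fun W => AddMonoidHom.ext fun x => ?_)
      have e : Cell.act f (imageOpen_le_iff.2 W.2) =
          (Cell.image A U).map (Cell.act ((Cell.preimage A U).map f) W.2) :=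
        Cell.hom_ext (A.res_res _ _ _).symm
      exact congrArg (fun g => (I.obj.map _).hom
        (φ.1 ⟨imageOpen W.1, (imageOpen_le_iff.2 W.2).trans f.hle⟩ ((M.unop.obj.map g).hom x)))
            e) fun α => by
    ext X φ
    exact Subtype.ext (funext fun W => AddMonoidHom.ext fun x => rfl)

/-- Internal morphisms into a direct image are the direct image of the internal morphisms from the
restriction. -/
noncomputable def internalHomPushIso (I : QCoh U.toScheme) :
    (internalHom A).obj ((push (structAlg Y) U).obj I) ≅
      (restrict A U).op ⋙ (internalHom (A.restrict U)).obj I ⋙ push A U :=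
  Functor.isoWhiskerRight (preHomPushIso A U I) (coherator A) ≪≫
    Functor.isoWhiskerLeft ((restrict A U).op ⋙ (preHom (A.restrict U)).obj I)
      (coheratorPushIso A U)

end internalHom

section affine
variable {X : Scheme.{u}} [IsAffine X] {A : GradedAlgebra X Λ}

/-- The cell of the sections of weight `i` over the whole affine scheme. -/
def topCell (A : GradedAlgebra X Λ) (i : Λ) : Cell A := ⟨⟨⊤, isAffineOpen_top X⟩, i⟩

lemma eq_zero_of_isZero_secAt_topCell {M : GrMod A} {i : Λ}
    (h : IsZero ((secAt (topCell A i)).obj M)) {V : X.affineOpens} (x : M.obj.obj ⟨V, i⟩) :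
    x = 0 := by
  have : Subsingleton (M.obj.obj ⟨⟨⊤, isAffineOpen_top X⟩, i⟩) :=
    AddCommGrpCat.subsingleton_of_isZero h
  refine eq_zero_of_locally_eq_zero M x fun y hy => ?_
  obtain ⟨g, hg, hyg⟩ := (isAffineOpen_top X).exists_basicOpen_le ⟨y, hy⟩ trivial
  refine ⟨X.affineBasicOpen (U := ⟨⊤, isAffineOpen_top X⟩) g, hg, hyg, ?_⟩
  obtain ⟨n, z, hz⟩ := M.property.qc_surj ⟨⊤, isAffineOpen_top X⟩ g i
    (M.obj.map (Cell.scal hg 1 i) x)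
  rw [Subsingleton.elim z 0, map_zero] at hz
  have e := congrArg (M.obj.map (Cell.scal le_rfl (finv ⟨⊤, isAffineOpen_top X⟩ g ^ n) i)) hz
  rw [map_zero, map_scal_scal, rs_self, ← mul_pow, finv_mul, one_pow, map_scal_one] at e
  exact e.symm

lemma exact_weight_of_exact_secAt_topCell {S : ShortComplex (GrMod A)} {i : Λ}
    (h : (S.map (secAt (topCell A i))).Exact) : (S.map (weight i)).Exact := by
  refine (exact_weight_iff S i).2 fun V => ?_
  rw [ShortComplex.exact_iff_isZero_homology] at h ⊢
  have hS := h.of_iso (S.mapHomologyIso (secAt (topCell A i))).symm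
  refine IsZero.of_iso ?_ (S.mapHomologyIso (secAt ⟨V, i⟩))
  have : Subsingleton ((secAt ⟨V, i⟩).obj S.homology) :=
    subsingleton_of_forall_eq 0 (eq_zero_of_isZero_secAt_topCell hS)
  exact AddCommGrpCat.isZero_of_subsingleton _

/-- The cells over an affine scheme are generated by global elements of the algebra. -/
def topCellHom {i : Λ} (Z : Cell A) (x : A.deg Z.U (Z.i + -i)) : topCell A i ⟶ Z :=
  Cell.Hom.mk x.1 (fun _ _ => trivial) ((sub_eq_add_neg Z.i i).symm ▸ x.2)

variable (A) in
/-- The unit of the algebra, as a generator of `A(-i)`. -/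
def twistGenerator (i : Λ) : ((twist (-i)).obj (selfMod A)).obj.obj (topCell A i) :=
  ⟨1, show 1 ∈ A.deg _ (i + -i) from (add_neg_cancel i).symm ▸ A.one_mem _⟩

lemma map_topCellHom_twistGenerator {i : Λ} (Z : Cell A) (x : A.deg Z.U (Z.i + -i)) :
    ((twist (-i)).obj (selfMod A)).obj.map (topCellHom Z x) (twistGenerator A i) = x :=
  Subtype.ext ((congrArg (x.1 * ·) (map_one (A.res _))).trans (mul_one x.1))

lemma bijective_app_twistGenerator {P : Cell A ⥤ AddCommGrpCat.{u}} (hP : isAdd A P) (i : Λ) :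
    Function.Bijective fun α : ((twist (-i)).obj (selfMod A)).obj ⟶ P =>
      α.app (topCell A i) (twistGenerator A i) := by
  refine ⟨fun α β h => ?_, fun p => ⟨?_, ?_⟩⟩
  · ext Z x
    have hα := ConcreteCategory.congr_hom (α.naturality (topCellHom Z x)) (twistGenerator A i)
    have hβ := ConcreteCategory.congr_hom (β.naturality (topCellHom Z x)) (twistGenerator A i)
    have hx := map_topCellHom_twistGenerator Z x
    exact ((congrArg (α.app Z) hx).symm.trans (hα.trans (congrArg (P.map _) h))).trans
      (hβ.symm.trans (congrArg (β.app Z) hx))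
  · exact
      { app Z := AddCommGrpCat.ofHom
          (AddMonoidHom.mk' (fun x => P.map (topCellHom Z x) p) fun x y =>
            ConcreteCategory.congr_hom (hP (topCellHom Z x) (topCellHom Z y) _ rfl) p)
        naturality Z T f := by
          ext x
          exact ConcreteCategory.congr_hom (congrArg (P.map ·)
            (Cell.hom_ext rfl : topCellHom T _ = topCellHom Z x ≫ f)) p |>.trans
              (ConcreteCategory.congr_hom (P.map_comp _ _) p) }
  · refine (ConcreteCategory.congr_hom (congrArg (P.map ·) (?_ : _ = 𝟙 _)) p).trans
      (ConcreteCategory.congr_hom (P.map_id _) p)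
    exact Cell.hom_ext rfl

lemma isIso_coherator_counit_app {P : Cell A ⥤ AddCommGrpCat.{u}} (hP : isAdd A P) (i : Λ) :
    IsIso (((Adjunction.ofIsLeftAdjoint (isGrMod A).ι).counit.app P).app (topCell A i)) := by
  let adj := Adjunction.ofIsLeftAdjoint (isGrMod A).ι
  let F := (twist (-i)).obj (selfMod A)
  have hcomp : Function.Bijective fun (α : (isGrMod A).ι.obj F ⟶
      (isGrMod A).ι.obj ((coherator A).obj P)) =>
        (α ≫ adj.counit.app P).app (topCell A i) (twistGenerator A i) :=
    (bijective_app_twistGenerator hP i).comp <|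
      (adj.homEquiv F P).symm.bijective.comp (isGrMod A).fullyFaithfulι.homEquiv.symm.bijective
  have h := (bijective_app_twistGenerator ((coherator A).obj P).property.map_add i)
  rw [ConcreteCategory.isIso_iff_bijective]
  exact (Function.Bijective.of_comp_iff _ h).1 hcomp

/-- Over an affine scheme, the coherator does not change the global sections of internal Homs. -/
noncomputable def internalHomSecAtTopIso (I : QCoh X) (i : Λ) :
    (internalHom A).obj I ⋙ secAt (topCell A i) ≅
      (preHom A).obj I ⋙ evFunctor A (topCell A i) :=
  NatIso.ofComponents (fun M =>
    @asIso _ _ _ _ _ (isIso_coherator_counit_app (isAdd_preHom I M) i)) fun f =>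
      congrArg (fun α => α.app (topCell A i))
        ((Adjunction.ofIsLeftAdjoint (isGrMod A).ι).counit.naturality (((preHom A).obj I).map f))

/-- The global sections of weight `i` of the sheaf of local morphisms are the morphisms of
modules. -/
def homSecTopEquiv (M : GrMod A) (I : QCoh X) (i : Λ) :
    HomSec M.obj I.obj (topCell A i) ≃+ ((weight (-i)).obj M ⟶ I) where
  toFun φ := ObjectProperty.homMk
    { app W := AddCommGrpCat.ofHom (φ.1 ⟨W.U, fun _ _ => trivial⟩)
      naturality {W W'} f := by
        ext x
        exact φ.2 ⟨W.U, fun _ _ => trivial⟩ ⟨W'.U, fun _ _ => trivial⟩ f.hle f.val x }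
  invFun α := ⟨fun W => (α.hom.app ⟨W.1, ⟨⟩⟩).hom, fun W W' h r x =>
    ConcreteCategory.congr_hom (α.hom.naturality (Cell.scal h r ⟨⟩)) x⟩
  left_inv _ := rfl
  right_inv _ := rfl
  map_add' _ _ := rfl

/-- The global sections of weight `i` of the graded sheaf Hom from `M` are the morphisms from the
component of `M` of weight `-i`. -/
noncomputable def preHomTopIso (I : QCoh X) (i : Λ) :
    (preHom A).obj I ⋙ evFunctor A (topCell A i) ≅ (weight (-i)).op ⋙ preadditiveYoneda.obj I :=
  NatIso.ofComponents (fun M => (homSecTopEquiv M.unop I i).toAddCommGrpIso) fun _ => rfl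

lemma exact_op_map_preadditiveYoneda_obj {C : Type*} [Category* C] [Abelian C] (I : C)
    [Injective I] {S : ShortComplex C} (hS : S.Exact) :
    (S.op.map (preadditiveYoneda.obj I)).Exact := by
  have := (Injective.injective_iff_preservesEpimorphisms_preadditiveYoneda_obj I).1 inferInstance
  have := preservesLimits_preadditiveYoneda_obj I
  have := Functor.preservesHomology_of_preservesEpis_and_kernels (preadditiveYoneda.obj I)
  exact hS.op.map _

lemma exact_internalHom_of_isAffine (I : QCoh X) [Injective I] {i : Λ}
    {S : ShortComplex (GrMod A)} (hS : (S.map (weight (-i))).Exact) :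
    (S.op.map ((internalHom A).obj I ⋙ weight i)).Exact := by
  refine exact_weight_of_exact_secAt_topCell (S := S.op.map ((internalHom A).obj I)) ?_
  exact (ShortComplex.exact_iff_of_iso
    (S.op.mapNatIso (internalHomSecAtTopIso I i ≪≫ preHomTopIso I i))).2
    (exact_op_map_preadditiveYoneda_obj I hS)

end affine

section gluing
variable {A : GradedAlgebra Y Λ}

instance (U : Y.Opens) : (restrict A U).Additive where

instance (U : Y.Opens) [IsAffineHom U.ι] : (push A U).Additive where

lemma exact_weight_restrict (U : Y.Opens) {S : ShortComplex (GrMod A)} {i : Λ}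
    (hS : (S.map (weight i)).Exact) : ((S.map (restrict A U)).map (weight i)).Exact :=
  (exact_weight_iff (S.map (restrict A U)) i).2 fun W => (exact_weight_iff S i).1 hS (imageOpen W)

lemma exact_weight_push (U : Y.Opens) [IsAffineHom U.ι]
    {S : ShortComplex (GrMod (A.restrict U))} {i : Λ} (hS : (S.map (weight i)).Exact) :
    ((S.map (push A U)).map (weight i)).Exact :=
  (exact_weight_iff (S.map (push A U)) i).2 fun V =>
    (exact_weight_iff S i).1 hS (preimageOpen U V)

lemma exact_internalHom_push (U : Y.Opens) [IsAffine U.toScheme] [IsAffineHom U.ι]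
    (I : QCoh U.toScheme) [Injective I] {i : Λ} {S : ShortComplex (GrMod A)}
    (hS : (S.map (weight (-i))).Exact) :
    (S.op.map ((internalHom A).obj ((push (structAlg Y) U).obj I) ⋙ weight i)).Exact :=
  (ShortComplex.exact_iff_of_iso
    (S.op.mapNatIso (Functor.isoWhiskerRight (internalHomPushIso A U I) (weight i)))).2
      (exact_weight_push U
        (S := (S.map (restrict A U)).op.map ((internalHom (A.restrict U)).obj I))
        (exact_internalHom_of_isAffine I (exact_weight_restrict U hS)))

lemma hom_eq_zero_of_restrict_eq_zero {κ : Type*} {U : κ → Y.Opens} [∀ a, IsAffineHom (U a).ι]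
    (hU : ∀ y, ∃ a, y ∈ U a) {M N : GrMod A} (g : M ⟶ N)
    (hg : ∀ a, (restrict A (U a)).map g = 0) : g = 0 := by
  ext X x
  refine eq_zero_of_locally_eq_zero N _ fun y hy => ?_
  obtain ⟨a, ha⟩ := hU y
  let W := preimageOpen (U a) X.U
  have hW := imageOpen_preimageOpen_le (U := U a) X.U
  refine ⟨imageOpen W, hW, ⟨⟨y, ha⟩, hy, rfl⟩, ?_⟩
  have hgx : g.hom.app ⟨imageOpen W, X.i⟩ = 0 :=
    congrArg (fun f => f.hom.app ⟨W, X.i⟩) (hg a)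
  exact (ConcreteCategory.congr_hom (g.hom.naturality (Cell.scal hW 1 X.i)) x).symm.trans
    (ConcreteCategory.congr_hom hgx _)

lemma mono_biproduct_lift_homEquiv {κ : Type*} [Finite κ] {U : κ → Y.Opens}
    [∀ a, IsAffineHom (U a).ι] (hU : ∀ y, ∃ a, y ∈ U a) [HasFiniteBiproducts (GrMod A)]
    {M : GrMod A} {I : ∀ a, GrMod (A.restrict (U a))} (φ : ∀ a, (restrict A (U a)).obj M ⟶ I a)
    [∀ a, Mono (φ a)] :
    Mono (biproduct.lift fun a => (restrictAdjPush A (U a)).homEquiv M (I a) (φ a)) := by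
  refine Preadditive.mono_of_cancel_zero _ fun g hg => ?_
  refine hom_eq_zero_of_restrict_eq_zero hU g fun a => ?_
  have h : g ≫ (restrictAdjPush A (U a)).homEquiv M (I a) (φ a) = 0 := by
    rw [← biproduct.lift_π (fun a => (restrictAdjPush A (U a)).homEquiv M (I a) (φ a)) a,
      reassoc_of% hg, zero_comp]
  rw [← Adjunction.homEquiv_naturality_left] at h
  rw [← cancel_mono (φ a), zero_comp, ← ((restrictAdjPush A (U a)).homEquiv _ _).apply_eq_iff_eq, h]
  exact ((restrictAdjPush A (U a)).homAddEquiv _ _).map_zero.symm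

/-- In other words, `J` is a direct summand of the sum of the `(push A (U a)).obj (I a)`. -/
lemma exists_sum_push_eq_id {κ : Type} [Fintype κ] {U : κ → Y.Opens} [∀ a, IsAffineHom (U a).ι]
    (hU : ∀ y, ∃ a, y ∈ U a) (J : GrMod A) [Injective J] :
    ∃ (I : ∀ a, GrMod (A.restrict (U a))) (s : ∀ a, J ⟶ (push A (U a)).obj (I a))
      (p : ∀ a, (push A (U a)).obj (I a) ⟶ J), (∀ a, Injective (I a)) ∧ ∑ a, s a ≫ p a = 𝟙 J := by
  have : HasFiniteBiproducts (GrMod A) := Abelian.hasFiniteBiproducts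
  let φ a := Injective.ι ((restrict A (U a)).obj J)
  let P a := (push A (U a)).obj (Injective.under ((restrict A (U a)).obj J))
  let s a : J ⟶ P a := (restrictAdjPush A (U a)).homEquiv J _ (φ a)
  have : Mono (biproduct.lift s) := mono_biproduct_lift_homEquiv hU φ
  let r := Injective.factorThru (𝟙 J) (biproduct.lift s)
  refine ⟨fun a => Injective.under ((restrict A (U a)).obj J), s, fun a => biproduct.ι P a ≫ r,
    fun a => inferInstance, ?_⟩
  calc ∑ a, s a ≫ biproduct.ι P a ≫ r
    _ = biproduct.lift s ≫ biproduct.desc fun a => biproduct.ι P a ≫ r :=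
      biproduct.lift_desc.symm
    _ = biproduct.lift s ≫ r :=
      congrArg _ (biproduct.hom_ext' _ _ fun a => biproduct.ι_desc _ a)
    _ = 𝟙 J := Injective.comp_factorThru _ _

lemma exact_map_of_sum_comp_eq_id {C D E κ : Type*} [Category* C] [Category* D] [Category* E]
    [Preadditive C] [Preadditive D] [Abelian E] [Fintype κ] (F : C ⥤ D ⥤ E) [F.Additive]
    [∀ J, (F.obj J).PreservesZeroMorphisms] (S : ShortComplex D) {J : C} {I : κ → C}
    (s : ∀ a, J ⟶ I a) (p : ∀ a, I a ⟶ J) (h : ∑ a, s a ≫ p a = 𝟙 J)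
    (hI : ∀ a, (S.map (F.obj (I a))).Exact) : (S.map (F.obj J)).Exact := by
  let Φ : C ⥤ ShortComplex E :=
    { obj J := S.map (F.obj J)
      map f := S.mapNatTrans (F.map f) }
  have : Φ.Additive := { map_add := by intros; ext <;> exact NatTrans.congr_app F.map_add _ }
  have e := congrArg (Φ ⋙ ShortComplex.homologyFunctor E).map h
  have hsp a : (Φ ⋙ ShortComplex.homologyFunctor E).map (s a) = 0 :=
    ((S.map _).exact_iff_isZero_homology.1 (hI a)).eq_zero_of_tgt _
  simp only [Functor.map_sum, Functor.map_comp, hsp, zero_comp, Finset.sum_const_zero] at e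
  rw [ShortComplex.exact_iff_isZero_homology, IsZero.iff_id_eq_zero]
  exact (e.trans (CategoryTheory.Functor.map_id _ _)).symm

lemma isAffineHom_ι_of_isAffineOpen [Y.IsSeparated] {U : Y.Opens} (hU : IsAffineOpen U) :
    IsAffineHom U.ι := by
  have : IsAffine U.toScheme := hU
  exact IsAffineHom.of_comp U.ι (terminal.from Y)

lemma exists_finite_affine_cover (Y : Scheme.{u}) [CompactSpace Y] :
    ∃ (n : ℕ) (U : Fin n → Y.affineOpens), ∀ y, ∃ a, y ∈ (U a).1 := by
  let 𝒰 := Y.affineCover.finiteSubcover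
  obtain ⟨n, ⟨e⟩⟩ := Finite.exists_equiv_fin 𝒰.I₀
  refine ⟨n, fun a => ⟨_, isAffineOpen_opensRange (𝒰.f (e.symm a))⟩, fun y => ?_⟩
  obtain ⟨a, ha⟩ := e.symm.surjective (𝒰.idx y)
  exact ⟨a, show y ∈ Set.range (𝒰.f (e.symm a)) from ha ▸ 𝒰.covers y⟩

theorem exact_internalHom [CompactSpace Y] [Y.IsSeparated] (J : QCoh Y) [Injective J] {i : Λ}
    {S : ShortComplex (GrMod A)} (hS : (S.map (weight (-i))).Exact) :
    (S.op.map ((internalHom A).obj J ⋙ weight i)).Exact := by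
  obtain ⟨n, U, hU⟩ := exists_finite_affine_cover Y
  have (a : _) : IsAffine (U a).1.toScheme := (U a).2
  have (a : _) := isAffineHom_ι_of_isAffineOpen (U a).2
  obtain ⟨I, s, p, hI, hsp⟩ := exists_sum_push_eq_id hU J
  let F := internalHom A ⋙ (Functor.whiskeringRight _ _ _).obj (weight i)
  have : F.Additive := { map_add := by intros; ext1; ext1; simp [F] }
  have (J : _) : (F.obj J).PreservesZeroMorphisms :=
    inferInstanceAs ((internalHom A).obj J ⋙ weight i).PreservesZeroMorphisms
  exact exact_map_of_sum_comp_eq_id F S.op s p hsp fun a =>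
    have : Injective (C := QCoh (U a).1.toScheme) (I a) := hI a
    exact_internalHom_push (U a).1 (I a) hS

end gluing

section products
variable {C κ : Type*} [Category* C]

lemma sum_π_comp_ι_eq_id [DecidableEq κ] [Preadditive C] (F : κ → C) [HasProduct F] {s : Finset κ}
    (hs : ∀ j ∉ s, IsZero (F j)) : ∑ j ∈ s, Pi.π F j ≫ Pi.ι F j = 𝟙 (∏ᶜ F) := by
  refine Pi.hom_ext _ _ fun k => ?_
  rw [Preadditive.sum_comp, Category.id_comp]
  by_cases hk : k ∈ s
  · rw [Finset.sum_eq_single_of_mem k hk fun j _ hj => by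
      rw [Category.assoc, Pi.ι_π_of_ne F hj, comp_zero], Category.assoc, Pi.ι_π_eq_id,
      Category.comp_id]
  · exact (hs k hk).eq_of_tgt _ _

lemma bijective_map_π_of_finite [Preadditive C] (G : C ⥤ AddCommGrpCat.{u}) [G.Additive]
    (F : κ → C) [HasProduct F] {s : Finset κ} (hs : ∀ j ∉ s, IsZero (F j)) :
    Function.Bijective fun (y : G.obj (∏ᶜ F)) (j : κ) => G.map (Pi.π F j) y := by
  classical
  have h_sum (y : G.obj (∏ᶜ F)) : ∑ j ∈ s, G.map (Pi.ι F j) (G.map (Pi.π F j) y) = y := by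
    have e := congrArg G.map (sum_π_comp_ι_eq_id F hs)
    simp only [G.map_sum, G.map_comp, CategoryTheory.Functor.map_id] at e
    let ev : (G.obj (∏ᶜ F) ⟶ G.obj (∏ᶜ F)) →+ G.obj (∏ᶜ F) :=
      AddMonoidHom.mk' (fun t => t y) fun _ _ => rfl
    exact (map_sum ev _ s).symm.trans (congrArg ev e)
  have h_app {j k : κ} (t : G.obj (F j)) :
      G.map (Pi.π F k) (G.map (Pi.ι F j) t) = G.map (Pi.ι F j ≫ Pi.π F k) t :=
    (ConcreteCategory.congr_hom (G.map_comp _ _) t).symm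
  refine ⟨fun x y h => ?_, fun t => ⟨∑ j ∈ s, G.map (Pi.ι F j) (t j), funext fun k => ?_⟩⟩
  · rw [← h_sum x, ← h_sum y]
    exact Finset.sum_congr rfl fun j _ => congrArg (G.map (Pi.ι F j)) (congrFun h j)
  · refine (map_sum (G.map (Pi.π F k)).hom _ s).trans ?_
    by_cases hk : k ∈ s
    · rw [Finset.sum_eq_single_of_mem k hk fun j _ hj => by
        rw [h_app, Pi.ι_π_of_ne F hj, G.map_zero]; rfl, h_app, Pi.ι_π_eq_id,
        CategoryTheory.Functor.map_id]
      rfl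
    · have := AddCommGrpCat.subsingleton_of_isZero (G.map_isZero (hs k hk))
      exact Subsingleton.elim _ _

lemma ι_comp_piMap [DecidableEq κ] [HasZeroMorphisms C] {F G : κ → C} [HasProduct F] [HasProduct G]
    (f : ∀ j, F j ⟶ G j) (j : κ) : Pi.ι F j ≫ Limits.Pi.map f = f j ≫ Pi.ι G j := by
  refine Pi.hom_ext _ _ fun k => ?_
  rw [Category.assoc, Category.assoc, Limits.Pi.map_π]
  by_cases hjk : j = k
  · subst hjk
    simp only [Pi.ι_π_eq_id, Pi.ι_π_eq_id_assoc, Category.comp_id]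
  · rw [Pi.ι_π_of_ne_assoc F hjk, Pi.ι_π_of_ne G hjk, zero_comp, comp_zero]

lemma shortExact_piMap_of_finite [Abelian C] [HasProductsOfShape κ C] {S : κ → ShortComplex C}
    (hS : ∀ j, (S j).ShortExact) {s : Finset κ} (hs : ∀ j ∉ s, IsZero (S j).X₃) :
    (ShortComplex.mk (Limits.Pi.map fun j => (S j).f) (Limits.Pi.map fun j => (S j).g)
      (by ext; simp)).ShortExact := by
  classical
  have hf j := (hS j).mono_f
  have hg j := (hS j).epi_g
  refine ShortComplex.ShortExact.mk' (ShortComplex.exact_of_f_is_kernel _ ?_) inferInstance ?_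
  · refine KernelFork.IsLimit.ofι' _ _ fun {W} k hk => ?_
    have hk' j : (k ≫ Pi.π _ j) ≫ (S j).g = 0 := by
      rw [Category.assoc, ← Limits.Pi.map_π fun j => (S j).g]
      exact hk =≫ Pi.π _ j |>.trans zero_comp |> (Category.assoc _ _ _).symm.trans
    refine ⟨Pi.lift fun j => (hS j).exact.lift (k ≫ Pi.π _ j) (hk' j), ?_⟩
    ext j
    simp [(hS j).exact.lift_f]
  · refine Preadditive.epi_of_cancel_zero _ fun {W} h e => ?_
    have hι j : Pi.ι (fun j => (S j).X₃) j ≫ h = 0 := by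
      rw [← cancel_epi (S j).g, ← Category.assoc, ← ι_comp_piMap fun j => (S j).g]
      exact (Category.assoc _ _ _).trans ((congrArg _ e).trans (comp_zero.trans comp_zero.symm))
    rw [← Category.id_comp h, ← sum_π_comp_ι_eq_id _ hs, Preadditive.sum_comp]
    exact Finset.sum_eq_zero fun j _ => by rw [Category.assoc, hι, comp_zero]

end products

section doubleComplex
variable {D : ℤ → ℤ → Type*} [∀ q n, AddCommGroup (D q n)]
  {dv : ∀ q n, D q n →+ D (q + 1) (n + 1)} {dh : ∀ q n, D q n →+ D q (n + 1)}
  (hvv : ∀ q n x, dv (q + 1) (n + 1) (dv q n x) = 0)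
  (hvh : ∀ q n x, dv q (n + 1) (dh q n x) = -dh (q + 1) (n + 1) (dv q n x))
  (hh : ∀ q n x, dh q (n + 1) x = 0 → ∃ w, dh q n w = x)

include hvv hvh hh

lemma exists_next_component_of_exact_row {q n : ℤ} {x : D q n} {x' : D (q + 1) n}
    {y : D (q + 1) (n + 1)} {y' : D (q + 1 + 1) (n + 1)} (hx : dv q n x + dh (q + 1) n x' = y)
    (hy : dv (q + 1) (n + 1) y + dh (q + 1 + 1) (n + 1) y' = 0) :
    ∃ w, dv (q + 1) n x' + dh (q + 1 + 1) n w = y' := by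
  have h_cycle : dh (q + 1 + 1) (n + 1) (y' - dv (q + 1) n x') = 0 := by
    rw [← hx, map_add, hvv, zero_add, hvh] at hy
    rw [map_sub, ← hy]
    abel
  obtain ⟨w, hw⟩ := hh _ _ _ h_cycle
  exact ⟨w, by rw [hw, add_sub_cancel]⟩

/-- Here `q` is the index of the row and `n` is the total degree. -/
theorem exists_boundary_of_exact_rows {m k : ℤ} (hm : ∀ q n, q < m → Subsingleton (D q n))
    (hk : ∀ q n, k < q → Subsingleton (D q n)) {n : ℤ} (y : ∀ q, D q (n + 1))
    (hy : ∀ q, dv q (n + 1) (y q) + dh (q + 1) (n + 1) (y (q + 1)) = 0) :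
    ∃ z : ∀ q, D q n, ∀ q, dv q n (z q) + dh (q + 1) n (z (q + 1)) = y (q + 1) := by
  suffices H : ∀ l : ℕ, ∃ z : ∀ q, D q n, ∀ q, q + 1 < m + l →
      dv q n (z q) + dh (q + 1) n (z (q + 1)) = y (q + 1) by
    obtain ⟨z, hz⟩ := H (k + 1 - m).toNat
    refine ⟨z, fun q => ?_⟩
    by_cases hq : k < q + 1
    · have := hk (q + 1) (n + 1) hq
      exact Subsingleton.elim _ _
    · exact hz q (by lia)
  intro l
  induction l with
  | zero =>
    refine ⟨0, fun q hq => ?_⟩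
    have := hm (q + 1) (n + 1) (by lia)
    exact Subsingleton.elim _ _
  | succ l ih =>
    obtain ⟨z, hz⟩ := ih
    obtain ⟨Q, hQ⟩ : ∃ Q, Q + 1 + 1 = m + l := ⟨m + l - 2, by ring⟩
    obtain ⟨w, hw⟩ := exists_next_component_of_exact_row hvv hvh hh (hz Q (by lia)) (hy (Q + 1))
    refine ⟨Function.update z (Q + 1 + 1) w, fun q hq => ?_⟩
    rw [Function.update_of_ne (by lia)]
    obtain rfl | hqQ := eq_or_ne q (Q + 1)
    · rw [Function.update_self, hw]
    · rw [Function.update_of_ne (by lia), hz q (by lia)]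

end doubleComplex

section exactness
variable {A : GradedAlgebra Y Λ}

lemma exact_iff_weight (S : ShortComplex (GrMod A)) :
    S.Exact ↔ ∀ i, (S.map (weight i)).Exact := by
  rw [exact_iff_secAt]
  exact ⟨fun h i => (exact_weight_iff S i).2 fun U => h ⟨U, i⟩,
    fun h X => (exact_weight_iff S X.i).1 (h X.i) X.U⟩

lemma exactFunctor_weight (i : Λ) : PreservesFiniteLimits (weight (A := A) i) ∧
    PreservesFiniteColimits (weight (A := A) i) :=
  ((Functor.exact_tfae (weight (A := A) i)).out 1 3).1 fun S hS => (exact_iff_weight S).1 hS i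

instance (i : Λ) : PreservesFiniteLimits (weight (A := A) i) := (exactFunctor_weight i).1

instance (i : Λ) : PreservesFiniteColimits (weight (A := A) i) := (exactFunctor_weight i).2

lemma exactFunctor_twist (a : Λ) : PreservesFiniteLimits (twist (A := A) a) ∧
    PreservesFiniteColimits (twist (A := A) a) :=
  ((Functor.exact_tfae (twist (A := A) a)).out 1 3).1 fun S hS =>
    (exact_iff_weight _).2 fun i => (exact_iff_weight S).1 hS (i + a)

instance (a : Λ) : PreservesFiniteLimits (twist (A := A) a) := (exactFunctor_twist a).1

instance (a : Λ) : PreservesFiniteColimits (twist (A := A) a) := (exactFunctor_twist a).2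

lemma isZeroInWeight_Q_obj_iff (i : Λ) (K : CochainComplex (GrMod A) ℤ) :
    IsZeroInWeight i (DerivedCategory.Q.obj K) ↔
      ∀ p q r, p + 1 = q → q + 1 = r → ((K.sc' p q r).map (weight i)).Exact := by
  have h_sc {p q r : ℤ} (h : p + 1 = q) (h' : q + 1 = r) :
      IsZero ((weight i).obj
        ((DerivedCategory.homologyFunctor (GrMod A) q).obj (DerivedCategory.Q.obj K))) ↔
      ((K.sc' p q r).map (weight i)).Exact := by
    rw [ShortComplex.exact_iff_isZero_homology]
    exact ((weight i).mapIso ((DerivedCategory.homologyFunctorFactors (GrMod A) q).app K ≪≫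
      ShortComplex.homologyMapIso (K.isoSc' p q r (by simp; omega) (by simp; omega))) ≪≫
      ((K.sc' p q r).mapHomologyIso (weight i)).symm).isZero_iff
  exact ⟨fun h p q r hp hq => (h_sc hp hq).1 (h q),
    fun h q => (h_sc (sub_add_cancel q 1) rfl).2 (h _ _ _ (sub_add_cancel q 1) rfl)⟩

lemma isZeroInWeight_Q_obj_twistCpx_iff (i a : Λ) (K : CochainComplex (GrMod A) ℤ) :
    IsZeroInWeight i (DerivedCategory.Q.obj ((twistCpx a).obj K)) ↔
      IsZeroInWeight (i + a) (DerivedCategory.Q.obj K) := by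
  rw [isZeroInWeight_Q_obj_iff, isZeroInWeight_Q_obj_iff]
  rfl

lemma shortExact_map_internalHom [CompactSpace Y] [Y.IsSeparated] (J : QCoh Y) [Injective J]
    {S : ShortComplex (GrMod A)} (hS : S.ShortExact) :
    (S.op.map ((internalHom A).obj J)).ShortExact := by
  have h_exact (T : ShortComplex (GrMod A)ᵒᵖ) (hT : T.Exact) :
      (T.map ((internalHom A).obj J)).Exact :=
    (exact_iff_weight _).2 fun i =>
      exact_internalHom J (S := T.unop) ((exact_iff_weight _).1 hT.unop (-i))
  have h_shortExact := ((Functor.exact_tfae ((internalHom A).obj J)).out 1 0).1 h_exact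
  exact h_shortExact _ hS.op

end exactness

section dual
variable {A : GradedAlgebra Y Λ} {J : CochainComplex (QCoh Y) ℤ}

lemma isZero_homQ (M : GrMod A) {G : QCoh Y} (hG : IsZero G) : IsZero (homQ M G) := by
  rw [IsZero.iff_id_eq_zero, ← homQMap_id, hG.eq_of_src (𝟙 G) 0, homQMap_zero_right]

/-- The factors of the degree `n` part of a Hom complex are indexed by the degree of the target. -/
def homIdxEquiv (n : ℤ) : ℤ ≃ HomIdx n where
  toFun q := ⟨(q - n, q), (sub_add_cancel q n).symm⟩
  invFun x := x.1.2
  left_inv _ := rfl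
  right_inv x := Subtype.ext (Prod.ext (by have := x.2; simp only; omega) rfl)

lemma exists_finset_isZero_homQ (hJ : ∃ m k : ℤ, J.IsStrictlyGE m ∧ J.IsStrictlyLE k)
    (M : CochainComplex (GrMod A) ℤ) (n : ℤ) :
    ∃ s : Finset (HomIdx n), ∀ x ∉ s, IsZero (homQ (M.X x.1.1) (J.X x.1.2)) := by
  obtain ⟨m, k, hm, hk⟩ := hJ
  refine ⟨(Finset.Icc m k).map (homIdxEquiv n).toEmbedding, fun x hx => isZero_homQ _ ?_⟩
  obtain h | h : x.1.2 < m ∨ k < x.1.2 := by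
    by_contra! h
    exact hx (Finset.mem_map.2 ⟨x.1.2, Finset.mem_Icc.2 h, (homIdxEquiv n).right_inv x⟩)
  · exact J.isZero_of_isStrictlyGE m _ h
  · exact J.isZero_of_isStrictlyLE k _ h

variable (J) in
/-- The component of the Hom complex with values in the degree `q` part of `J`. -/
noncomputable abbrev dualπ (M : CochainComplex (GrMod A) ℤ) (n q : ℤ) :
    dualX J M n ⟶ homQ (M.X (q - n)) (J.X q) :=
  Pi.π (fun x : HomIdx n => homQ (M.X x.1.1) (J.X x.1.2)) (homIdxEquiv n q)

lemma bijective_dualπ (hJ : ∃ m k : ℤ, J.IsStrictlyGE m ∧ J.IsStrictlyLE k)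
    (M : CochainComplex (GrMod A) ℤ) (n : ℤ) (X : Cell A) :
    Function.Bijective fun (y : (secAt X).obj (dualX J M n)) (q : ℤ) =>
      (secAt X).map (dualπ J M n q) y := by
  obtain ⟨s, hs⟩ := exists_finset_isZero_homQ hJ M n
  exact (Equiv.piCongrLeft (fun x : HomIdx n => (secAt X).obj (homQ (M.X x.1.1) (J.X x.1.2)))
    (homIdxEquiv n)).symm.bijective.comp (bijective_map_π_of_finite (secAt X) _ hs)

lemma dualD_comp_dualπ (M : CochainComplex (GrMod A) ℤ) (n q : ℤ) :
    dualD J M n ≫ dualπ J M (n + 1) (q + 1) =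
      dualπ J M n q ≫ homQMap (M.XIsoOfEq (by ring)).hom (J.d q (q + 1)) +
      (n + 1).negOnePow • (dualπ J M n (q + 1) ≫
        homQMap (M.d (q + 1 - (n + 1)) (q + 1 - n)) (𝟙 (J.X (q + 1)))) := by
  have h_π {p p' q' : ℤ} (hp : p' = p) (hq : q = q') (h : q = p' + n) (h' : q' = p + n) :
      Pi.π (fun x : HomIdx n => homQ (M.X x.1.1) (J.X x.1.2)) ⟨(p', q), h⟩ ≫
        homQMap (M.XIsoOfEq hp.symm).hom (J.d q (q + 1)) =
      Pi.π (fun x : HomIdx n => homQ (M.X x.1.1) (J.X x.1.2)) ⟨(p, q'), h'⟩ ≫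
        homQMap (𝟙 (M.X p)) (J.d q' (q + 1)) := by
    subst hp hq
    rfl
  have h_π' {p p' : ℤ} (hp : p' = p) (h : q + 1 = p + n) (h' : q + 1 = p' + n) (r : ℤ) :
      Pi.π (fun x : HomIdx n => homQ (M.X x.1.1) (J.X x.1.2)) ⟨(p, q + 1), h⟩ ≫
        homQMap (M.d r p) (𝟙 (J.X (q + 1))) =
      Pi.π (fun x : HomIdx n => homQ (M.X x.1.1) (J.X x.1.2)) ⟨(p', q + 1), h'⟩ ≫
        homQMap (M.d r p') (𝟙 (J.X (q + 1))) := by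
    subst hp
    rfl
  refine (Pi.lift_π _ _).trans (congrArg₂ (fun s t => s + (n + 1).negOnePow • t) ?_ ?_)
  · exact (h_π (p := q + 1 - (n + 1)) (q' := q + 1 - 1) (by ring) (by ring) _ _).symm
  · exact h_π' (p := q + 1 - (n + 1) + 1) (by ring) _ _ _

variable (J) in
lemma dualMap_comp {K L M : CochainComplex (GrMod A) ℤ} (f : K ⟶ L) (g : L ⟶ M) :
    dualMap J (f ≫ g) = dualMap J g ≫ dualMap J f := by
  ext n : 1
  refine Pi.hom_ext _ _ fun x => ?_
  change dualMapX J (f ≫ g) n ≫ _ = (dualMapX J g n ≫ dualMapX J f n) ≫ _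
  simp [dualMapX, homQMap_comp]

variable (J) in
lemma dualMap_zero (K L : CochainComplex (GrMod A) ℤ) : dualMap J (0 : K ⟶ L) = 0 := by
  ext n : 1
  refine Pi.hom_ext _ _ fun x => ?_
  change dualMapX J 0 n ≫ _ = (0 : dualX J L n ⟶ dualX J K n) ≫ _
  simp [dualMapX, homQMap_zero_left]

variable (J) in
/-- The short complex of the Hom complexes into `J` from the terms of a short complex. -/
noncomputable abbrev dualShortComplex (S : ShortComplex (CochainComplex (GrMod A) ℤ)) :
    ShortComplex (CochainComplex (GrMod A) ℤ) :=
  ShortComplex.mk (dualMap J S.g) (dualMap J S.f) (by rw [← dualMap_comp, S.zero, dualMap_zero])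

theorem shortExact_dualShortComplex [CompactSpace Y] [Y.IsSeparated]
    (hJ : ∃ m k : ℤ, J.IsStrictlyGE m ∧ J.IsStrictlyLE k) (hJ' : ∀ n, Injective (J.X n))
    {S : ShortComplex (CochainComplex (GrMod A) ℤ)} (hS : S.ShortExact) :
    (dualShortComplex J S).ShortExact := by
  refine HomologicalComplex.shortExact_of_degreewise_shortExact _ fun n => ?_
  obtain ⟨s, hs⟩ := exists_finset_isZero_homQ hJ S.X₁ n
  exact shortExact_piMap_of_finite (S := fun x : HomIdx n =>
    (S.map (HomologicalComplex.eval _ _ x.1.1)).op.map ((internalHom A).obj (J.X x.1.2)))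
    (fun x => shortExact_map_internalHom _
      (hS.map_of_exact (HomologicalComplex.eval _ _ x.1.1))) hs

end dual

section dualVanishing
variable {A : GradedAlgebra Y Λ} {J : CochainComplex (QCoh Y) ℤ}

section rows
variable (J) (K : CochainComplex (GrMod A) ℤ) (q n : ℤ)

/-- The differential of the Hom double complex induced by the differential of `J`. -/
noncomputable def dualRowMap :
    homQ (K.X (q - n)) (J.X q) ⟶ homQ (K.X (q + 1 - (n + 1))) (J.X (q + 1)) :=
  homQMap (K.XIsoOfEq (by ring)).hom (J.d q (q + 1))

/-- The differential of the Hom double complex induced by the differential of `K`, with the sign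
that it has in the total complex. -/
noncomputable def dualRowD :
    homQ (K.X (q - n)) (J.X q) ⟶ homQ (K.X (q - (n + 1))) (J.X q) :=
  (n + 1).negOnePow • homQMap (K.d (q - (n + 1)) (q - n)) (𝟙 (J.X q))

lemma dualRowMap_comp_dualRowMap :
    dualRowMap J K q n ≫ dualRowMap J K (q + 1) (n + 1) = 0 := by
  rw [dualRowMap, dualRowMap, homQMap_comp, J.d_comp_d, homQMap_zero_right]

lemma dualRowD_comp_dualRowMap :
    dualRowD J K q n ≫ dualRowMap J K q (n + 1) =
      -(dualRowMap J K q n ≫ dualRowD J K (q + 1) (n + 1)) := by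
  simp only [dualRowD, dualRowMap, Int.negOnePow_succ, Linear.units_smul_comp,
    Linear.comp_units_smul, homQMap_comp, Category.id_comp, Category.comp_id,
    HomologicalComplex.XIsoOfEq_hom_comp_d, HomologicalComplex.d_comp_XIsoOfEq_hom,
    Units.neg_smul, Preadditive.neg_comp, neg_neg]

variable {K} in
lemma exists_dualRowD_eq [CompactSpace Y] [Y.IsSeparated] (hJ : ∀ n, Injective (J.X n)) {i : Λ}
    (hK : IsZeroInWeight (-i) (DerivedCategory.Q.obj K)) (U : Y.affineOpens)
    (x : (secAt ⟨U, i⟩).obj (homQ (K.X (q - (n + 1))) (J.X q)))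
    (hx : (secAt ⟨U, i⟩).map (dualRowD J K q (n + 1)) x = 0) :
    ∃ w, (secAt ⟨U, i⟩).map (dualRowD J K q n) w = x := by
  have h_row := (isZeroInWeight_Q_obj_iff _ _).1 hK (q - (n + 1 + 1)) (q - (n + 1)) (q - n)
    (by ring) (by ring)
  have h_exact := (exact_weight_iff (ShortComplex.map _ ((internalHom A).obj (J.X q))) i).1
    (exact_internalHom (J.X q) h_row) U
  have h_smul {M N : GrMod A} (e : ℤˣ) (f : M ⟶ N) (t : (secAt ⟨U, i⟩).obj M) :
      (secAt ⟨U, i⟩).map (e • f) t = e • (secAt ⟨U, i⟩).map f t := by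
    rw [Functor.map_units_smul]
    rfl
  rw [dualRowD, h_smul, smul_eq_zero_iff_eq] at hx
  obtain ⟨w, hw⟩ : ∃ w : (secAt ⟨U, i⟩).obj (homQ (K.X (q - n)) (J.X q)),
      (secAt ⟨U, i⟩).map (homQMap (K.d (q - (n + 1)) (q - n)) (𝟙 (J.X q))) w = x :=
    (ShortComplex.ab_exact_iff _).1 h_exact x hx
  refine ⟨(n + 1).negOnePow • w, (h_smul _ _ _).trans ?_⟩
  rw [Units.smul_def, Units.smul_def, map_zsmul, hw, smul_smul, ← Units.val_mul,
    Int.units_mul_self, Units.val_one, one_smul]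

variable (X : Cell A) {K} {q n}

lemma map_dualRowMap_map_dualRowMap (y : (secAt X).obj (homQ (K.X (q - n)) (J.X q))) :
    (secAt X).map (dualRowMap J K (q + 1) (n + 1)) ((secAt X).map (dualRowMap J K q n) y) = 0 := by
  have h := congrArg (fun f => (secAt X).map f y) (dualRowMap_comp_dualRowMap J K q n)
  simp only [Functor.map_comp, Functor.map_zero] at h
  exact h

lemma map_dualRowMap_map_dualRowD (y : (secAt X).obj (homQ (K.X (q - n)) (J.X q))) :
    (secAt X).map (dualRowMap J K q (n + 1)) ((secAt X).map (dualRowD J K q n) y) =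
      -(secAt X).map (dualRowD J K (q + 1) (n + 1)) ((secAt X).map (dualRowMap J K q n) y) := by
  have h := congrArg (fun f => (secAt X).map f y) (dualRowD_comp_dualRowMap J K q n)
  simp only [Functor.map_comp, Functor.map_neg] at h
  exact h

lemma map_dualπ_map_dualD (y : (secAt X).obj (dualX J K n)) :
    (secAt X).map (dualπ J K (n + 1) (q + 1)) ((secAt X).map (dualD J K n) y) =
      (secAt X).map (dualRowMap J K q n) ((secAt X).map (dualπ J K n q) y) +
        (secAt X).map (dualRowD J K (q + 1) n) ((secAt X).map (dualπ J K n (q + 1)) y) := by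
  have h := dualD_comp_dualπ (J := J) K n q
  rw [← Linear.comp_units_smul] at h
  have h' := congrArg (fun f => (secAt X).map f y) h
  simp only [Functor.map_comp, Functor.map_add] at h'
  exact h'

end rows

lemma exists_dualD_eq [CompactSpace Y] [Y.IsSeparated]
    (hJ : ∃ m k : ℤ, J.IsStrictlyGE m ∧ J.IsStrictlyLE k) (hJ' : ∀ n, Injective (J.X n))
    {K : CochainComplex (GrMod A) ℤ} {i : Λ} (hK : IsZeroInWeight (-i) (DerivedCategory.Q.obj K))
    (U : Y.affineOpens) (n : ℤ) (x : (secAt ⟨U, i⟩).obj (dualX J K (n + 1)))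
    (hx : (secAt ⟨U, i⟩).map (dualD J K (n + 1)) x = 0) :
    ∃ w, (secAt ⟨U, i⟩).map (dualD J K n) w = x := by
  obtain ⟨m, k, hm, hk⟩ := id hJ
  have h_sub {q : ℤ} (h : IsZero (J.X q)) (n : ℤ) :
      Subsingleton ((secAt ⟨U, i⟩).obj (homQ (K.X (q - n)) (J.X q))) :=
    AddCommGrpCat.subsingleton_of_isZero ((secAt ⟨U, i⟩).map_isZero (isZero_homQ _ h))
  obtain ⟨z, hz⟩ := exists_boundary_of_exact_rows
    (D := fun q n => (secAt ⟨U, i⟩).obj (homQ (K.X (q - n)) (J.X q)))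
    (dv := fun q n => ((secAt ⟨U, i⟩).map (dualRowMap J K q n)).hom)
    (dh := fun q n => ((secAt ⟨U, i⟩).map (dualRowD J K q n)).hom)
    (fun _ _ => map_dualRowMap_map_dualRowMap J _) (fun _ _ => map_dualRowMap_map_dualRowD J _)
    (fun q n => exists_dualRowD_eq J q n hJ' hK U)
    (fun q n h => h_sub (J.isZero_of_isStrictlyGE m _ h) n)
    (fun q n h => h_sub (J.isZero_of_isStrictlyLE k _ h) n)
    (fun q => (secAt ⟨U, i⟩).map (dualπ J K (n + 1) q) x)
    (fun q => (map_dualπ_map_dualD J _ x).symm.trans (by rw [hx, map_zero]))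
  obtain ⟨w, hw⟩ := (bijective_dualπ hJ K n ⟨U, i⟩).2 z
  refine ⟨w, (bijective_dualπ hJ K (n + 1) ⟨U, i⟩).1 (funext fun q => ?_)⟩
  obtain ⟨q, rfl⟩ : ∃ p, q = p + 1 := ⟨q - 1, by ring⟩
  refine (map_dualπ_map_dualD J _ w).trans (Eq.trans ?_ (hz q))
  rw [← hw]

theorem isZeroInWeight_dual [CompactSpace Y] [Y.IsSeparated]
    (hJ : ∃ m k : ℤ, J.IsStrictlyGE m ∧ J.IsStrictlyLE k) (hJ' : ∀ n, Injective (J.X n))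
    {K : CochainComplex (GrMod A) ℤ} {i : Λ} (hK : IsZeroInWeight (-i) (DerivedCategory.Q.obj K)) :
    IsZeroInWeight i (DerivedCategory.Q.obj (dual J K)) := by
  rw [isZeroInWeight_Q_obj_iff]
  rintro n _ _ rfl rfl
  have h_d (n : ℤ) : (dual J K).d n (n + 1) = dualD J K n := CochainComplex.of_d _ _ _
  refine (exact_weight_iff _ i).2 fun U => (ShortComplex.ab_exact_iff _).2 fun x hx => ?_
  obtain ⟨w, hw⟩ := exists_dualD_eq hJ hJ' hK U n x
    ((congrArg (fun f => (secAt ⟨U, i⟩).map f x) (h_d (n + 1))).symm.trans hx)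
  exact ⟨w, (congrArg (fun f => (secAt ⟨U, i⟩).map f w) (h_d n)).trans hw⟩

end dualVanishing

section derived
variable {C D : Type*} [Category* C] [Abelian C] [Category* D] [Abelian D] (F : C ⥤ D) [F.Additive]
  [PreservesFiniteLimits F] [PreservesFiniteColimits F]

/-- The extension of an exact functor to derived categories commutes with cohomology. -/
noncomputable def mapDerivedCategoryHomologyIso (n : ℤ) :
    F.mapDerivedCategory ⋙ DerivedCategory.homologyFunctor D n ≅
      DerivedCategory.homologyFunctor C n ⋙ F :=
  Localization.liftNatIso DerivedCategory.Q (HomologicalComplex.quasiIso C (.up ℤ))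
    (DerivedCategory.Q ⋙ F.mapDerivedCategory ⋙ DerivedCategory.homologyFunctor D n)
    (DerivedCategory.Q ⋙ DerivedCategory.homologyFunctor C n ⋙ F) _ _
    (Functor.isoWhiskerRight F.mapDerivedCategoryFactors (DerivedCategory.homologyFunctor D n) ≪≫
      Functor.isoWhiskerLeft (F.mapHomologicalComplex (.up ℤ))
        (DerivedCategory.homologyFunctorFactors D n) ≪≫
      Functor.isoWhiskerLeft (HomologicalComplex.shortComplexFunctor C (.up ℤ) n)
        (ShortComplex.homologyFunctorIso F) ≪≫
      Functor.isoWhiskerRight (DerivedCategory.homologyFunctorFactors C n).symm F)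

lemma isIso_mapDerivedCategory_map_iff {K L : DerivedCategory C} (φ : K ⟶ L) :
    IsIso (F.mapDerivedCategory.map φ) ↔
      ∀ n : ℤ, IsIso (F.map ((DerivedCategory.homologyFunctor C n).map φ)) := by
  rw [DerivedCategory.isIso_iff]
  exact forall_congr' fun n => NatIso.isIso_map_iff (mapDerivedCategoryHomologyIso F n) φ

lemma isZero_iff_isZero_homology (K : DerivedCategory C) :
    IsZero K ↔ ∀ n : ℤ, IsZero ((DerivedCategory.homologyFunctor C n).obj K) := by
  refine ⟨fun h n => (DerivedCategory.homologyFunctor C n).map_isZero h, fun h => ?_⟩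
  have : IsIso (0 : K ⟶ K) := by
    rw [DerivedCategory.isIso_iff]
    exact fun n => (h n).isIso (h n) _
  rw [IsZero.iff_id_eq_zero]
  exact isIsoZeroSelfEquiv _ this

lemma isZero_mapDerivedCategory_obj_iff (K : DerivedCategory C) :
    IsZero (F.mapDerivedCategory.obj K) ↔
      ∀ n : ℤ, IsZero (F.obj ((DerivedCategory.homologyFunctor C n).obj K)) := by
  rw [isZero_iff_isZero_homology]
  exact forall_congr' fun n => ((mapDerivedCategoryHomologyIso F n).app K).isZero_iff

end derived

section weights
variable {A : GradedAlgebra Y Λ} {i : Λ} {K L M : DerivedCategory (GrMod A)}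

lemma quasiIsoInWeight_iff (φ : K ⟶ L) :
    QuasiIsoInWeight i φ ↔ IsIso ((weight i).mapDerivedCategory.map φ) :=
  (isIso_mapDerivedCategory_map_iff (weight i) φ).symm

lemma isZeroInWeight_iff : IsZeroInWeight i K ↔ IsZero ((weight i).mapDerivedCategory.obj K) :=
  (isZero_mapDerivedCategory_obj_iff (weight i) K).symm

lemma isZero_iff_isZeroInWeight : IsZero K ↔ ∀ i, IsZeroInWeight i K := by
  refine (isZero_iff_isZero_homology K).trans ⟨fun h i n => (weight i).map_isZero (h n),
    fun h n => (isZero_iff_secAt _).2 fun X => (isZero_weight_iff _ X.i).1 (h X.i n) X.U⟩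

lemma IsZeroInWeight.shift (h : IsZeroInWeight i K) (n : ℤ) : IsZeroInWeight i (K⟦n⟧) := by
  rw [isZeroInWeight_iff] at h ⊢
  exact ((shiftFunctor _ n).map_isZero h).of_iso
    (((weight i).mapDerivedCategory.commShiftIso n).app K)

lemma QuasiIsoInWeight.comp {φ : K ⟶ L} {ψ : L ⟶ M} (hφ : QuasiIsoInWeight i φ)
    (hψ : QuasiIsoInWeight i ψ) : QuasiIsoInWeight i (φ ≫ ψ) := by
  rw [quasiIsoInWeight_iff] at *
  rw [Functor.map_comp]
  infer_instance

lemma IsZeroInWeight.quasiIsoInWeight (hK : IsZeroInWeight i K) (hL : IsZeroInWeight i L)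
    (φ : K ⟶ L) : QuasiIsoInWeight i φ := by
  rw [isZeroInWeight_iff] at hK hL
  rw [quasiIsoInWeight_iff]
  exact hK.isIso hL _

open Pretriangulated

lemma quasiIsoInWeight_mor₁ {T : Triangle (DerivedCategory (GrMod A))} (hT : T ∈ distTriang _)
    (h : IsZeroInWeight i T.obj₃) : QuasiIsoInWeight i T.mor₁ := by
  rw [isZeroInWeight_iff] at h
  rw [quasiIsoInWeight_iff]
  exact (Triangle.isZero₃_iff_isIso₁ _
    ((weight i).mapDerivedCategory.map_distinguished T hT)).1 h

lemma quasiIsoInWeight_mor₂ {T : Triangle (DerivedCategory (GrMod A))} (hT : T ∈ distTriang _)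
    (h : IsZeroInWeight i T.obj₁) : QuasiIsoInWeight i T.mor₂ := by
  rw [isZeroInWeight_iff] at h
  rw [quasiIsoInWeight_iff]
  exact (Triangle.isZero₁_iff_isIso₂ _
    ((weight i).mapDerivedCategory.map_distinguished T hT)).1 h

lemma quasiIsoInWeight_hom₃ {T T' : Triangle (DerivedCategory (GrMod A))}
    (hT : T ∈ distTriang _) (hT' : T' ∈ distTriang _) (φ : T ⟶ T')
    (h₁ : QuasiIsoInWeight i φ.hom₁) (h₂ : QuasiIsoInWeight i φ.hom₂) :
    QuasiIsoInWeight i φ.hom₃ := by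
  rw [quasiIsoInWeight_iff] at *
  exact isIso₃_of_isIso₁₂ ((weight i).mapDerivedCategory.mapTriangle.map φ)
    ((weight i).mapDerivedCategory.map_distinguished T hT)
    ((weight i).mapDerivedCategory.map_distinguished T' hT') h₁ h₂

end weights

section resolution
variable {A : GradedAlgebra Y Λ} {J : CochainComplex (QCoh Y) ℤ}

lemma mono_injectiveResolution_ι' {C : Type*} [Category* C] [Abelian C] {X : C}
    (R : InjectiveResolution X) : Mono R.ι' := by
  refine HomologicalComplex.mono_of_mono_f _ fun n => ?_
  by_cases hn : n = 0
  · subst hn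
    rw [InjectiveResolution.ι'_f_zero]
    have : Mono (R.ι.f 0) := inferInstance
    have h_self : Mono (HomologicalComplex.singleObjXSelf (.up ℤ) 0 X).hom := inferInstance
    exact mono_comp' h_self (mono_comp (R.ι.f 0) (R.cochainComplexXIso 0 0 rfl).inv)
  · exact ⟨fun g h _ =>
      (HomologicalComplex.isZero_single_obj_X (.up ℤ) 0 X n hn).eq_of_tgt _ _⟩

variable (A) in
/-- The quasi-isomorphism from `A` to its injective resolution. -/
noncomputable def resolι : selfCpx A ⟶ resol A := (injectiveResolution (selfMod A)).ι'

instance : Mono (resolι A) := mono_injectiveResolution_ι' (injectiveResolution (selfMod A))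

instance : QuasiIso (resolι A) :=
  inferInstanceAs (QuasiIso (injectiveResolution (selfMod A)).ι')

open DerivedCategory Pretriangulated

lemma isIso_Q_map_dualMap [CompactSpace Y] [Y.IsSeparated]
    (hJ : ∃ m k : ℤ, J.IsStrictlyGE m ∧ J.IsStrictlyLE k) (hJ' : ∀ n, Injective (J.X n))
    {K L : CochainComplex (GrMod A) ℤ} (f : K ⟶ L) [Mono f] [QuasiIso f] :
    IsIso (Q.map (dualMap J f)) := by
  let S := ShortComplex.mk f (cokernel.π f) (cokernel.condition f)
  have hS : S.ShortExact :=
    { exact := ShortComplex.exact_cokernel f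
      mono_f := inferInstanceAs (Mono f)
      epi_g := inferInstanceAs (Epi (cokernel.π f)) }
  have h_coker : IsZero (Q.obj S.X₃) :=
    (Triangle.isZero₃_iff_isIso₁ _ (triangleOfSES_distinguished hS)).2
      (inferInstanceAs (IsIso (Q.map f)))
  have h_dual_coker : IsZero (Q.obj (dual J S.X₃)) := isZero_iff_isZeroInWeight.2 fun i =>
    isZeroInWeight_dual hJ hJ' (isZero_iff_isZeroInWeight.1 h_coker (-i))
  exact (Triangle.isZero₁_iff_isIso₂ _
    (triangleOfSES_distinguished (shortExact_dualShortComplex hJ hJ' hS))).1 h_dual_coker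

end resolution

section localCohomology
variable {A : GradedAlgebra Y Λ}

instance mono_Γtorsι_app (S : Set Λ) (M : GrMod A) : Mono ((Γtorsι S).app M) where
  right_cancellation {N} g h e := by
    have : Mono ((torsPreι S).app M) := by
      rw [NatTrans.mono_iff_mono_app]
      exact fun X => (AddCommGrpCat.mono_iff_injective _).2 Subtype.val_injective
    let adj := Adjunction.ofIsLeftAdjoint (isGrMod A).ι
    have h_counit (f : N ⟶ (Γtors S).obj M) : (f ≫ (Γtorsι S).app M).hom =
        (adj.homEquiv N _).symm f ≫ (torsPreι S).app M :=
      (Category.assoc _ _ _).symm.trans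
        (congrArg (· ≫ (torsPreι S).app M) (adj.homEquiv_counit N _ f).symm)
    refine (adj.homEquiv N _).symm.injective ((cancel_mono ((torsPreι S).app M)).1 ?_)
    exact (h_counit g).symm.trans ((congrArg (fun t => t.hom) e).trans (h_counit h))

instance mono_RΓι (S : Set Λ) : Mono (RΓι A S) :=
  HomologicalComplex.mono_of_mono_f _ fun _ => mono_Γtorsι_app S _

variable (A) in
/-- The short exact sequence of complexes that underlies the local cohomology triangle. -/
noncomputable def localCohomologySequence (S : Set Λ) :
    ShortComplex (CochainComplex (GrMod A) ℤ) :=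
  ShortComplex.mk (RΓι A S) (cokernel.π (RΓι A S)) (cokernel.condition _)

lemma shortExact_localCohomologySequence (S : Set Λ) :
    (localCohomologySequence A S).ShortExact where
  exact := ShortComplex.exact_cokernel _
  mono_f := mono_RΓι S
  epi_g := inferInstanceAs (Epi (cokernel.π (RΓι A S)))

lemma shortExact_map_twistCpx (a : Λ) {S : ShortComplex (CochainComplex (GrMod A) ℤ)}
    (hS : S.ShortExact) : (S.map (twistCpx a)).ShortExact :=
  HomologicalComplex.shortExact_of_degreewise_shortExact _ fun n =>
    (hS.map_of_exact (HomologicalComplex.eval _ _ n)).map_of_exact (twist a)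

end localCohomology

section flips
variable {A : GradedAlgebra Y Λ} {J : CochainComplex (QCoh Y) ℤ} {a : Λ} {S T : Set Λ}

open DerivedCategory Pretriangulated

variable (A) in
/-- The map to the Čech complex from the injective resolution of `A`, which represents `A` in the
derived category. -/
noncomputable abbrev cechπ (S : Set Λ) : resol A ⟶ cech A S := cokernel.π (RΓι A S)

lemma quasiIsoInWeight_twistCpx_cechπ {i : Λ} (h : IsZeroInWeight (i + a) (Q.obj (RΓ A S))) :
    QuasiIsoInWeight i (Q.map ((twistCpx a).map (cechπ A S))) :=
  quasiIsoInWeight_mor₂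
    (triangleOfSES_distinguished (shortExact_map_twistCpx a (shortExact_localCohomologySequence S)))
    ((isZeroInWeight_Q_obj_twistCpx_iff i a _).2 h)

lemma quasiIsoInWeight_dualMap_cechπ [CompactSpace Y] [Y.IsSeparated]
    (hJ : ∃ m k : ℤ, J.IsStrictlyGE m ∧ J.IsStrictlyLE k) (hJ' : ∀ n, Injective (J.X n)) {i : Λ}
    (h : IsZeroInWeight (-i) (Q.obj (RΓ A S))) :
    QuasiIsoInWeight i (Q.map (dualMap J (cechπ A S))) :=
  quasiIsoInWeight_mor₁ (triangleOfSES_distinguished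
    (shortExact_dualShortComplex hJ hJ' (shortExact_localCohomologySequence S)))
    (isZeroInWeight_dual hJ hJ' h)

lemma eta_comp_dualMap_eta (φ : Q.obj ((twistCpx a).obj (cech A S)) ⟶ Q.obj (dual J (cech A S))) :
    Q.map ((twistCpx a).map (eta A S)) ≫ φ ≫ Q.map (dualMap J (eta A S)) =
      Q.map ((twistCpx a).map (resolι A)) ≫
        (Q.map ((twistCpx a).map (cechπ A S)) ≫ φ ≫ Q.map (dualMap J (cechπ A S))) ≫
          Q.map (dualMap J (resolι A)) := by
  have h_eta : eta A S = resolι A ≫ cechπ A S := rfl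
  simp only [h_eta, dualMap_comp, Functor.map_comp, Category.assoc]

lemma cechπ_compat [CompactSpace Y] [Y.IsSeparated]
    (hJ : ∃ m k : ℤ, J.IsStrictlyGE m ∧ J.IsStrictlyLE k) (hJ' : ∀ n, Injective (J.X n))
    {φ : Q.obj ((twistCpx a).obj (cech A S)) ⟶ Q.obj (dual J (cech A S))}
    {ψ : Q.obj ((twistCpx a).obj (cech A T)) ⟶ Q.obj (dual J (cech A T))}
    (h : Q.map ((twistCpx a).map (eta A S)) ≫ φ ≫ Q.map (dualMap J (eta A S)) =
      Q.map ((twistCpx a).map (eta A T)) ≫ ψ ≫ Q.map (dualMap J (eta A T))) :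
    Q.map ((twistCpx a).map (cechπ A S)) ≫ φ ≫ Q.map (dualMap J (cechπ A S)) =
      Q.map ((twistCpx a).map (cechπ A T)) ≫ ψ ≫ Q.map (dualMap J (cechπ A T)) := by
  have := isIso_Q_map_dualMap hJ hJ' (resolι A)
  have : IsIso (Q.map ((twistCpx a).map (resolι A))) := inferInstance
  rw [eta_comp_dualMap_eta, eta_comp_dualMap_eta] at h
  exact (cancel_mono (Q.map (dualMap J (resolι A)))).1
    ((cancel_epi (Q.map ((twistCpx a).map (resolι A)))).1 h)

end flips

end HFF

open DerivedCategory Pretriangulated in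
theorem theorem5p5_general {Y : Scheme.{u}} [CompactSpace Y] [Y.IsSeparated] {Λ : Type}
    [AddCommGroup Λ] [DecidableEq Λ] {A : HFF.GradedAlgebra Y Λ}
    {J : CochainComplex (HFF.QCoh Y) ℤ} (hJ : ∃ m k : ℤ, J.IsStrictlyGE m ∧ J.IsStrictlyLE k)
    (hJ' : ∀ n, Injective (J.X n)) {a : Λ} {S T : Set Λ}
    {φ : Q.obj ((HFF.twistCpx a).obj (HFF.cech A S)) ⟶ Q.obj (HFF.dual J (HFF.cech A S))}
    {ψ : Q.obj ((HFF.twistCpx a).obj (HFF.cech A T)) ⟶ Q.obj (HFF.dual J (HFF.cech A T))}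
    (hφ : ∀ i, HFF.QuasiIsoInWeight i φ) (hψ : ∀ i, HFF.QuasiIsoInWeight i ψ)
    (h_compat : Q.map ((HFF.twistCpx a).map (HFF.eta A S)) ≫ φ ≫
        Q.map (HFF.dualMap J (HFF.eta A S)) =
      Q.map ((HFF.twistCpx a).map (HFF.eta A T)) ≫ ψ ≫ Q.map (HFF.dualMap J (HFF.eta A T))) :
    ∃ Ψ : (Q.obj ((HFF.twistCpx a).obj (HFF.RΓ A S)))⟦(1 : ℤ)⟧ ⟶ Q.obj (HFF.dual J (HFF.RΓ A T)),
      ∀ i, (HFF.IsZeroInWeight (i + a) (Q.obj (HFF.RΓ A S)) ∧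
            HFF.IsZeroInWeight (-i) (Q.obj (HFF.RΓ A T)) ∨
          HFF.IsZeroInWeight (-i) (Q.obj (HFF.RΓ A S)) ∧
            HFF.IsZeroInWeight (i + a) (Q.obj (HFF.RΓ A T))) →
        HFF.QuasiIsoInWeight i Ψ := by
  have h_twist := rot_of_distTriang _ (triangleOfSES_distinguished
    (HFF.shortExact_map_twistCpx a (HFF.shortExact_localCohomologySequence (A := A) S)))
  have h_dual := triangleOfSES_distinguished
    (HFF.shortExact_dualShortComplex hJ hJ' (HFF.shortExact_localCohomologySequence (A := A) T))
  have h_square := (HFF.cechπ_compat hJ hJ' h_compat).trans (Category.assoc _ _ _).symm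
  obtain ⟨Ψ, h₁, h₂⟩ := complete_distinguished_triangle_morphism _ _ h_twist h_dual
    (Q.map ((HFF.twistCpx a).map (HFF.cechπ A T)) ≫ ψ)
    (φ ≫ Q.map (HFF.dualMap J (HFF.cechπ A S))) h_square
  refine ⟨Ψ, fun i => ?_⟩
  rintro (⟨hS, hT⟩ | ⟨hS, hT⟩)
  · exact (((HFF.isZeroInWeight_Q_obj_twistCpx_iff i a _).2 hS).shift 1).quasiIsoInWeight
      (HFF.isZeroInWeight_dual hJ hJ' hT) Ψ
  · exact HFF.quasiIsoInWeight_hom₃ h_twist h_dual (Triangle.homMk _ _ _ _ Ψ h_square h₁ h₂)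
      (HFF.QuasiIsoInWeight.comp (HFF.quasiIsoInWeight_twistCpx_cechπ hT) (hψ i))
      ((hφ i).comp (HFF.quasiIsoInWeight_dualMap_cechπ hJ hJ' hS))

theorem theorem5p5 {Y : Scheme.{u}} [AlgebraicGeometry.IsNoetherian Y] [Y.IsSeparated]
    (F : HFF.HomologicalFlipFlop Y) :
    ∃ Ψ : (DerivedCategory.Q.obj
          ((HFF.twistCpx F.a).obj (HFF.RΓ F.A (Set.Ioi 0))))⟦(1 : ℤ)⟧ ⟶
        DerivedCategory.Q.obj (HFF.dual F.ω (HFF.RΓ F.A (Set.Iio 0))),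
      ∀ cpos cneg : ℤ,
        (∀ i : ℤ, cpos ≤ i →
          HFF.IsZeroInWeight i (DerivedCategory.Q.obj (HFF.RΓ F.A (Set.Ioi 0)))) →
        (∀ i : ℤ, i ≤ cneg →
          HFF.IsZeroInWeight i (DerivedCategory.Q.obj (HFF.RΓ F.A (Set.Iio 0)))) →
        ∀ i : ℤ, (max (-cneg) (cpos - F.a) ≤ i ∨ i ≤ min (-cpos) (cneg - F.a)) →
          HFF.QuasiIsoInWeight i Ψ := by
  obtain ⟨Ψ, hΨ⟩ := theorem5p5_general F.isDualizing.bounded F.isDualizing.injective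
    F.quasiIso_pos F.quasiIso_neg F.compat
  exact ⟨Ψ, fun cpos cneg hpos hneg i hi => hΨ i (hi.imp
    (fun h => ⟨hpos _ (by omega), hneg _ (by omega)⟩)
    (fun h => ⟨hpos _ (by omega), hneg _ (by omega)⟩))⟩
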